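/- Let $\omega\ge 2$ be an integer. For integers $N,d\ge 0$ let $\mathcal G(N,d,\omega)$ be the class of all chordal graphs $G$ on $N$ vertices (simple graphs with no induced cycle of length four or more) with maximum degree at most $d$ and clique number at most $\omega$. Each vertex of $G\in\mathcal G(N,d,\omega)$ is sampled independently with probability $p$; one observes the set $S$ of sampled vertices and the induced subgraph $G[S]$. Let $\mathsf{cc}(G)$ be the number of connected components of $G$, and let $$R(N,d,\omega,p)=\inf_{\widehat{\mathsf{cc}}}\ \sup_{G\in\mathcal G(N,d,\omega)}\mathbb E_G\big|\widehat{\mathsf{cc}}-\mathsf{cc}(G)\big|^2,$$ where the infimum is over all real-valued functions $\widehat{\mathsf{cc}}$ of the observation $(S,G[S])$ (which may depend on $N,d,\omega,p$). Then there are constants $c_\omega,C_\omega>0$ depending only on $\omega$ such that, for all $N,d$ and all $0<p<\frac{1}{100\cdot 2^{\omega}}$, $$R(N,d,\omega,p)\ \le\ C_\omega\left(\Big(\frac{N}{p^{\omega}}\vee\frac{Nd}{p^{\omega-1}}\Big)\wedge N^2\right),$$ and, if moreover $N\ge 2$ and $d\ge\omega-1$, $$R(N,d,\omega,p)\ \ge\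 c_\omega\left(\Big(\frac{N}{p^{\omega}}\vee\frac{Nd}{p^{\omega-1}}\Big)\wedge N^2\right).$$ In particular, for $N\ge2$ and $d\ge\omega-1$, $R(N,d,\omega,p)=\Theta_\omega\big((\frac{N}{p^{\omega}}\vee\frac{Nd}{p^{\omega-1}})\wedge N^2\big)$. -/

import Mathlib

open scoped ENNReal

noncomputable section

namespace ChordalSampling

/-- A graph is chordal if it has no induced cycle of length four or more. -/
def IsChordal {V : Type*} (G : SimpleGraph V) : Prop :=
  ∀ k : ℕ, 4 ≤ k → ¬ (SimpleGraph.cycleGraph k).IsIndContained G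

/-- The number of connected components of `G`. -/
def cc {V : Type*} (G : SimpleGraph V) : ℕ := Nat.card G.ConnectedComponent

open Classical in
/-- The class of chordal graphs on `N` (labelled) vertices with maximum degree at most `d`
and clique number at most `ω`. -/
def chordalClass (N d ω : ℕ) : Set (SimpleGraph (Fin N)) :=
  {G | IsChordal G ∧ G.maxDegree ≤ d ∧ G.cliqueNum ≤ ω}

/-- An estimator is an arbitrary real function of the observation, that is, of the set `S` of
sampled vertices and of a graph on `S` (the induced subgraph). -/
abbrev Estimator (N : ℕ) : Type :=
  (S : Finset (Fin N)) → SimpleGraph S → ℝ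

/-- The subgraph of `G` induced by the sampled vertices `S`. -/
def sampled {N : ℕ} (G : SimpleGraph (Fin N)) (S : Finset (Fin N)) : SimpleGraph S :=
  G.comap (fun v : S => (v : Fin N))

/-- The probability that the set of sampled vertices is exactly `S` when each of the `N` vertices
is sampled independently with probability `p`. -/
def sampleProb {N : ℕ} (p : ℝ) (S : Finset (Fin N)) : ℝ :=
  p ^ S.card * (1 - p) ^ (N - S.card)

/-- The mean squared error of the estimator `f` of the number of connected components when the
parent graph is `G`, under Bernoulli sampling with sampling ratio `p`. -/
def mse {N : ℕ} (p : ℝ) (f : Estimator N) (G : SimpleGraph (Fin N)) : ℝ :=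
  ∑ S : Finset (Fin N), sampleProb p S * (f S (sampled G S) - (cc G : ℝ)) ^ 2

/-- The minimax mean squared error over the class of chordal graphs. The estimator may depend on
`N`, `d`, `ω` and `p`, but not on the parent graph. -/
def minimaxMSE (N d ω : ℕ) (p : ℝ) : ℝ≥0∞ :=
  ⨅ f : Estimator N, ⨆ G ∈ chordalClass N d ω, ENNReal.ofReal (mse p f G)

/-- The rate `(N / p ^ ω ∨ N d / p ^ (ω - 1)) ∧ N ^ 2`. -/
def rate (N d ω : ℕ) (p : ℝ) : ℝ :=
  min (max ((N : ℝ) / p ^ ω) ((N : ℝ) * (d : ℝ) / p ^ (ω - 1))) ((N : ℝ) ^ 2)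

end ChordalSampling

end

/-!
**Upper bound.** A chordal graph has a simplicial vertex (Dirac's theorem,
`IsChordal.exists_simplicial`), hence a perfect elimination order. Adding a simplicial vertex `v`
with neighbours `Q` creates the cliques `insert v U`, `U ⊆ Q`. It follows by induction that the
number of components is the alternating sum over the nonempty cliques `T` of `(-1) ^ (T.card + 1)`
(`IsChordal.cc_eq_sum_cliquesIn`), and that there are at most `2 ^ ω` cliques per vertex. The
Horvitz–Thompson estimator `cliqueEstimator` of this sum is unbiased, and its variance is
`∑ T T', ± (p⁻¹ ^ (T ∩ T').card - 1)`. The diagonal is of order `N / p ^ ω`. The clique bound,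
applied to neighbourhoods, shows that only `O(N d)` pairs of different cliques meet, and they do so
in at most `ω - 1` vertices. This is the rate, up to the trivial bound `N ^ 2` of the estimator `0`.

**Lower bound.** Consider disjoint blocks of `k` core vertices and `m` leaves. Random bits decide
which core vertices of a block are active; these form a clique that is joined to all leaves of the
block, and all other core vertices are isolated. If a core vertex of a block has not been sampled,
then flipping its bit changes the parity of the block but not the observation, so an observation
reveals the parities of the full blocks only, and a block is full with probability `p ^ k`. On the
other hand the number of components of a block is correlated with its parity
(`sum_blockCC_mul_paritySign`), because a block without active core vertices has `m` components
instead of one. Compare the uniform prior on the bits with a prior which gives every parity a bias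
`e`. The expected number of components differs by the order of `|m - 1| e M`, where `M` is the number
of blocks (`m e M` if `k = 1`), whereas an estimator can only exploit the bias in about
`M p ^ k` full blocks, which do not reveal it if `e ^ 2 * M * p ^ k` is bounded. The Cauchy–Schwarz
inequality (`sq_shift_le`) turns this into a lower bound for the risk of order `(m - 1) ^ 2 * min (M ^ 2) (M / p ^ k)`
(`blockBound_le_minimaxMSE`). The choice `k = ω`, `m = 0`, `M ≈ N / ω` gives the term
`N / p ^ ω` of the rate, and `k = ω - 1`, `m ≈ min d N / 2`, `M ≈ N / m` gives `N d / p ^ (ω - 1)`.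
-/

namespace ChordalSampling

open Finset
open scoped ENNReal

/-! ### Simplicial vertices of chordal graphs -/

section Graphs

variable {V : Type*}

/-- The spanning subgraph of `G` that keeps exactly the edges with both ends in `W`; the vertices
outside `W` become isolated. -/
def spanned (G : SimpleGraph V) (W : Finset V) : SimpleGraph V where
  Adj u v := G.Adj u v ∧ u ∈ W ∧ v ∈ W
  symm := ⟨fun _ _ h => ⟨h.1.symm, h.2.2, h.2.1⟩⟩
  loopless := ⟨fun _ h => G.loopless.irrefl _ h.1⟩

/-- `r` sends every vertex to a chosen representative of its connected component. -/
structure IsRep (G : SimpleGraph V) (r : V → V) : Prop where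
  adj : ∀ u v, G.Adj u v → r u = r v
  reach : ∀ v, G.Reachable v (r v)

theorem IsRep.eq_of_reachable {G : SimpleGraph V} {r : V → V} (h : IsRep G r) {u v : V}
    (huv : G.Reachable u v) : r u = r v := by
  obtain ⟨p⟩ := huv
  induction p with
  | nil => rfl
  | cons hadj _ ih => exact (h.adj _ _ hadj).trans ih

theorem IsRep.cc_eq [Fintype V] [DecidableEq V] {G : SimpleGraph V} {r : V → V}
    (h : IsRep G r) : cc G = #{v | r v = v} := by
  have hb : Function.Bijective
      (fun v : {v // r v = v} => G.connectedComponentMk v.1) := by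
    constructor
    · rintro ⟨u, hu⟩ ⟨v, hv⟩ huv
      have := h.eq_of_reachable (SimpleGraph.ConnectedComponent.exact huv)
      exact Subtype.ext (by simpa [hu, hv] using this)
    · intro C
      induction C using SimpleGraph.ConnectedComponent.ind with
      | _ v =>
        exact ⟨⟨r v, (h.eq_of_reachable (h.reach v)).symm⟩,
          SimpleGraph.ConnectedComponent.sound (h.reach v).symm⟩
  unfold cc
  rw [← Nat.card_congr (Equiv.ofBijective _ hb), Nat.card_eq_fintype_card, Fintype.card_subtype]

/-- A shortest path is an induced path. -/
theorem exists_induced_path {H : SimpleGraph V} {s t : V} (h : H.Reachable s t) :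
    ∃ (n : ℕ) (p : ℕ → V), p 0 = s ∧ p n = t ∧ (∀ i < n, H.Adj (p i) (p (i + 1))) ∧
      (∀ i j, i < j → j ≤ n → p i ≠ p j) ∧
      (∀ i j, i < j → j ≤ n → H.Adj (p i) (p j) → j = i + 1) := by
  obtain ⟨w, hw⟩ := h.exists_walk_length_eq_dist
  have key : ∀ i j, i < j → j ≤ w.length → ∀ q : H.Walk (w.getVert i) (w.getVert j),
      j ≤ i + q.length := by
    intro i j hij hj q
    have h1 := SimpleGraph.dist_le (((w.take i).append q).append (w.drop j))
    simp only [SimpleGraph.Walk.length_append, SimpleGraph.Walk.take_length,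
      SimpleGraph.Walk.drop_length] at h1
    omega
  refine ⟨w.length, w.getVert, w.getVert_zero, w.getVert_length,
    fun i hi => w.adj_getVert_succ hi, ?_, ?_⟩
  · intro i j hij hj he
    have := key i j hij hj (SimpleGraph.Walk.nil.copy rfl he)
    simp at this
    omega
  · intro i j hij hj ha
    have := key i j hij hj (SimpleGraph.Walk.cons ha SimpleGraph.Walk.nil)
    simp at this
    omega

/-- The induced path `p 0, …, p n` closed up by a vertex `v` that is adjacent to the two ends only
is an induced cycle of length `n + 2`. -/
theorem IsChordal.false_of_induced_path {G : SimpleGraph V} (hG : IsChordal G) {n : ℕ} (hn : 2 ≤ n)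
    {p : ℕ → V} {v : V} (hinj : ∀ i j, i < j → j ≤ n → p i ≠ p j) (hv : ∀ i ≤ n, p i ≠ v)
    (hadj : ∀ i j, i < j → j ≤ n → (G.Adj (p i) (p j) ↔ j = i + 1))
    (hadjv : ∀ i ≤ n, (G.Adj (p i) v ↔ i = 0 ∨ i = n)) : False := by
  have hcyc : ∀ a b : Fin (n + 2), a < b → ((SimpleGraph.cycleGraph (n + 2)).Adj a b ↔
      (b : ℕ) = a + 1 ∨ ((a : ℕ) = 0 ∧ (b : ℕ) = n + 1)) := by
    intro a b hab
    have hab' : (a : ℕ) < b := hab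
    have hb := b.isLt
    rw [SimpleGraph.cycleGraph_adj', Fin.val_sub, Fin.val_sub]
    rw [show n + 2 - (a : ℕ) + b = (b - a) + (n + 2) by omega, Nat.add_mod_right,
      Nat.mod_eq_of_lt (show (b : ℕ) - a < n + 2 by omega),
      Nat.mod_eq_of_lt (show n + 2 - (b : ℕ) + a < n + 2 by omega)]
    omega
  let f : Fin (n + 2) → V := fun a => if (a : ℕ) ≤ n then p a else v
  have hlt : ∀ a b : Fin (n + 2), a < b →
      f a ≠ f b ∧ (G.Adj (f a) (f b) ↔ (SimpleGraph.cycleGraph (n + 2)).Adj a b) := by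
    intro a b hab
    have hab' : (a : ℕ) < b := hab
    have hb := b.isLt
    have ha : (a : ℕ) ≤ n := by omega
    rw [hcyc a b hab]
    by_cases hbn : (b : ℕ) ≤ n
    · simp only [f, ha, hbn, if_true]
      refine ⟨hinj _ _ hab' hbn, (hadj _ _ hab' hbn).trans ?_⟩
      omega
    · simp only [f, ha, hbn, if_true, if_false]
      refine ⟨hv _ ha, (hadjv _ ha).trans ?_⟩
      omega
  refine hG (n + 2) (by omega) ⟨⟨⟨f, ?_⟩, ?_⟩⟩
  · intro a b hab
    by_contra hne
    rcases lt_or_gt_of_ne hne with h | h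
    · exact (hlt _ _ h).1 hab
    · exact (hlt _ _ h).1 hab.symm
  · intro a b
    change G.Adj (f a) (f b) ↔ _
    rcases lt_trichotomy a b with h | h | h
    · exact (hlt _ _ h).2
    · subst h; simp
    · rw [G.adj_comm, SimpleGraph.adj_comm _ a b]; exact (hlt _ _ h).2

open Classical in
/-- In a chordal graph, the vertices outside a connected set `C` of non-neighbours of `v` which are
adjacent both to `v` and to `C` form a clique: two non-adjacent ones would be the ends of an induced
path through `C`, which `v` closes to a long induced cycle. -/
theorem IsChordal.attachment_isClique {G : SimpleGraph V} (hG : IsChordal G)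
    {v w : V} {C : Finset V} (hC : ∀ c ∈ C, (spanned G C).Reachable w c)
    (hCv : ∀ c ∈ C, c ≠ v ∧ ¬ G.Adj v c) {s t : V} (hs : G.Adj v s) (ht : G.Adj v t)
    {a b : V} (ha : a ∈ C) (hb : b ∈ C) (hsa : G.Adj s a) (htb : G.Adj t b) (hst : s ≠ t) :
    G.Adj s t := by
  by_contra hn
  set D : Finset V := insert s (insert t C) with hD
  have hmono : spanned G C ≤ spanned G D := fun x y h =>
    ⟨h.1, by simp [hD, h.2.1], by simp [hD, h.2.2]⟩
  have h1 : (spanned G D).Adj s a := ⟨hsa, by simp [hD], by simp [hD, ha]⟩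
  have h2 : (spanned G D).Adj t b := ⟨htb, by simp [hD], by simp [hD, hb]⟩
  have hr : (spanned G D).Reachable s t :=
    h1.reachable.trans (((hC a ha).symm.trans (hC b hb)).mono hmono |>.trans h2.symm.reachable)
  obtain ⟨n, p, hp0, hpn, hstep, hinj, hind⟩ := exists_induced_path hr
  have hn2 : 2 ≤ n := by
    rcases n with _ | _ | n
    · exact absurd (hp0.symm.trans hpn) hst
    · have := (hstep 0 (by omega)).1
      simp only [zero_add] at this hpn
      rw [hp0, hpn] at this
      exact absurd this hn
    · omega
  have hmem : ∀ i ≤ n, p i ∈ D := by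
    intro i hi
    rcases Nat.lt_or_ge i n with h | h
    · exact (hstep i h).2.1
    · obtain rfl : i = n := by omega
      rw [hpn]; simp [hD]
  have hint : ∀ i, 0 < i → i < n → p i ∈ C := by
    intro i h0 hi
    have h := hmem i hi.le
    rw [hD, mem_insert, mem_insert] at h
    rcases h with h | h | h
    · exact absurd (hp0.trans h.symm) (hinj 0 i h0 hi.le)
    · exact absurd (h.trans hpn.symm) (hinj i n hi le_rfl)
    · exact h
  refine hG.false_of_induced_path hn2 hinj (v := v) ?_ ?_ ?_
  · intro i hi
    rcases Nat.eq_zero_or_pos i with rfl | h0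
    · rw [hp0]; exact hs.ne'
    · rcases hi.eq_or_lt with rfl | h
      · rw [hpn]; exact ht.ne'
      · exact (hCv _ (hint i h0 h)).1
  · intro i j hij hj
    constructor
    · intro h
      exact hind i j hij hj ⟨h, hmem i (by omega), hmem j hj⟩
    · rintro rfl
      exact (hstep i (by omega)).1
  · intro i hi
    rcases Nat.eq_zero_or_pos i with rfl | h0
    · simp [hp0, hs.symm]
    · rcases hi.eq_or_lt with rfl | h
      · simp [hpn, ht.symm]
      · have := (hCv _ (hint i h0 h)).2
        rw [G.adj_comm] at this
        simp only [this, false_iff]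
        omega

open Classical in
/-- Dirac's theorem on simplicial vertices, in the strengthened form that makes the induction run:
if `K` is a clique and `K ≠ W`, then the subgraph of a chordal graph induced by `W` has a simplicial
vertex outside `K`. -/
theorem IsChordal.exists_simplicial {G : SimpleGraph V} (hG : IsChordal G) (W K : Finset V)
    (hKW : K ⊆ W) (hK : G.IsClique K) (hne : K ≠ W) :
    ∃ v ∈ W, v ∉ K ∧ G.IsClique (W.filter (G.Adj v) : Finset V) := by
  induction hcard : W.card using Nat.strong_induction_on generalizing W K with
  | _ n ih =>
  by_cases hW : G.IsClique W
  · obtain ⟨v, hv, hvK⟩ := exists_of_ssubset (hKW.ssubset_of_ne hne)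
    exact ⟨v, hv, hvK, hW.subset (coe_subset.2 (filter_subset _ _))⟩
  -- `v` is taken in `K` if possible, so that no non-neighbour of `v` in `W` lies in `K`.
  have hvw : ∃ v ∈ W, ∃ w ∈ W, w ≠ v ∧ ¬ G.Adj v w ∧
      ∀ z ∈ W, z ≠ v → ¬ G.Adj v z → z ∉ K := by
    by_cases h : ∃ v ∈ K, ∃ w ∈ W, w ≠ v ∧ ¬ G.Adj v w
    · obtain ⟨v, hv, w, hw, hwv, hn⟩ := h
      exact ⟨v, hKW hv, w, hw, hwv, hn, fun z _ hzv hz hzK => hz (hK hv hzK hzv.symm)⟩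
    · push Not at h
      simp only [SimpleGraph.IsClique, Set.Pairwise] at hW
      push Not at hW
      obtain ⟨v, hv, w, hw, hvw, hn⟩ := hW
      exact ⟨v, hv, w, hw, hvw.symm, hn, fun z _ hzv hz hzK => hz (h z hzK v hv hzv.symm).symm⟩
  obtain ⟨v, hv, w, hw, hwv, hnadj, hout⟩ := hvw
  set R := W.filter (fun u => u ≠ v ∧ ¬ G.Adj v u) with hR
  have hwR : w ∈ R := by simp [hR, hw, hwv, hnadj]
  set C := R.filter (fun u => (spanned G R).Reachable w u) with hCdef
  have hwC : w ∈ C := by simp [hCdef, hwR]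
  have hC : ∀ c ∈ C, (spanned G C).Reachable w c := by
    intro c hc
    have hc' := (mem_filter.1 hc).2
    rw [SimpleGraph.reachable_iff_reflTransGen] at hc'
    clear hc
    induction hc' with
    | refl => exact SimpleGraph.Reachable.refl _
    | @tail b c hb hbc ihb =>
      have hb' : (spanned G R).Reachable w b :=
        (SimpleGraph.reachable_iff_reflTransGen _ _).2 hb
      have : (spanned G C).Adj b c :=
        ⟨hbc.1, mem_filter.2 ⟨hbc.2.1, hb'⟩, mem_filter.2 ⟨hbc.2.2, hb'.trans hbc.reachable⟩⟩
      exact ihb.trans this.reachable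
  have hCR : ∀ c ∈ C, c ∈ W ∧ c ≠ v ∧ ¬ G.Adj v c := by
    intro c hc
    simpa [hR] using (mem_filter.1 hc).1
  set S := W.filter (fun s => G.Adj v s ∧ ∃ c ∈ C, G.Adj s c) with hS
  have hSclique : G.IsClique S := by
    intro s hs t ht hst
    obtain ⟨-, hvs, a, ha, hsa⟩ := mem_filter.1 (mem_coe.1 hs)
    obtain ⟨-, hvt, b, hb, htb⟩ := mem_filter.1 (mem_coe.1 ht)
    exact hG.attachment_isClique hC (fun c hc => (hCR c hc).2) hvs hvt ha hb hsa htb hst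
  have hsub : C ∪ S ⊆ W := union_subset (fun c hc => (hCR c hc).1) (filter_subset _ _)
  have hvnot : v ∉ C ∪ S := by
    rw [mem_union]
    rintro (h | h)
    · exact (hCR v h).2.1 rfl
    · exact G.loopless.irrefl _ (mem_filter.1 h).2.1
  have hlt : (C ∪ S).card < n := hcard ▸ card_lt_card (ssubset_of_subset_of_ne hsub
    (fun h => hvnot (h ▸ hv)))
  have hSne : S ≠ C ∪ S := by
    intro h
    have : w ∈ S := h ▸ mem_union_left _ hwC
    exact hnadj (mem_filter.1 this).2.1
  obtain ⟨z, hz, hzS, hzc⟩ := ih _ hlt (C ∪ S) S subset_union_right hSclique hSne rfl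
  have hzC : z ∈ C := (mem_union.1 hz).resolve_right hzS
  obtain ⟨hzW, hzv, hzn⟩ := hCR z hzC
  refine ⟨z, hzW, hout z hzW hzv hzn, hzc.subset ?_⟩
  intro u hu
  obtain ⟨huW, hzu⟩ := mem_filter.1 (mem_coe.1 hu)
  refine mem_coe.2 (mem_filter.2 ⟨?_, hzu⟩)
  by_cases hvu : G.Adj v u
  · exact mem_union_right _ (mem_filter.2 ⟨huW, hvu, z, hzC, hzu.symm⟩)
  · have huv : u ≠ v := by rintro rfl; exact hzn hzu.symm
    have huR : u ∈ R := mem_filter.2 ⟨huW, huv, hvu⟩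
    have hzR := mem_filter.1 hzC
    have hzu' : (spanned G R).Adj z u := ⟨hzu, hzR.1, huR⟩
    exact mem_union_left _ (mem_filter.2 ⟨huR, hzR.2.trans hzu'.reachable⟩)

open Classical in
/-- Perfect elimination: a property of vertex sets of a chordal graph holds for all sets if it holds
for `∅` and is preserved when a simplicial vertex is added. -/
theorem IsChordal.elimination_induction {G : SimpleGraph V} (hG : IsChordal G)
    {P : Finset V → Prop} (empty : P ∅)
    (insert : ∀ (W : Finset V) (v : V), v ∉ W → G.IsClique (W.filter (G.Adj v) : Finset V) →
      P W → P (insert v W)) (W : Finset V) : P W := by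
  induction hcard : W.card generalizing W with
  | zero => rwa [card_eq_zero.1 hcard]
  | succ n ih =>
    have hne : (∅ : Finset V) ≠ W := by rintro rfl; simp at hcard
    obtain ⟨v, hv, -, hcl⟩ := hG.exists_simplicial W ∅ (empty_subset _) (by simp) hne
    have := insert (W.erase v) v (notMem_erase v W)
      (hcl.subset (by intro u; simp +contextual)) (ih _ (by rw [card_erase_of_mem hv, hcard]; rfl))
    rwa [insert_erase hv] at this

end Graphs

/-! ### Cliques and components of chordal graphs -/

section Cliques

variable {V : Type*}

open Classical in
/-- The nonempty cliques of `G` that are contained in `W`. -/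
noncomputable def cliquesIn (G : SimpleGraph V) (W : Finset V) : Finset (Finset V) :=
  W.powerset.filter fun T => T.Nonempty ∧ G.IsClique (T : Set V)

theorem mem_cliquesIn {G : SimpleGraph V} {W T : Finset V} :
    T ∈ cliquesIn G W ↔ T ⊆ W ∧ T.Nonempty ∧ G.IsClique (T : Set V) := by
  simp [cliquesIn]

open Classical in
/-- The cliques created by adding a simplicial vertex `v` are the sets `insert v U`, where `U` is
any set of neighbours of `v`. -/
theorem sum_cliquesIn_insert {G : SimpleGraph V} {W : Finset V} {v : V} (hv : v ∉ W)
    (hQ : G.IsClique (W.filter (G.Adj v) : Finset V)) {R : Type*} [AddCommMonoid R]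
    (f : Finset V → R) :
    ∑ T ∈ cliquesIn G (insert v W), f T =
      ∑ T ∈ cliquesIn G W, f T + ∑ U ∈ (W.filter (G.Adj v)).powerset, f (insert v U) := by
  have hvU : ∀ U ∈ (W.filter (G.Adj v)).powerset, v ∉ U := fun U hU h =>
    hv (mem_filter.1 (mem_powerset.1 hU h)).1
  have hinj : Set.InjOn (insert v) ((W.filter (G.Adj v)).powerset : Set (Finset V)) := by
    intro A hA B hB hAB
    rw [← erase_insert (hvU A hA), hAB, erase_insert (hvU B hB)]
  rw [← sum_image hinj, ← sum_union]
  · congr 1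
    ext T
    simp only [mem_union, mem_image, mem_cliquesIn, mem_powerset]
    constructor
    · rintro ⟨hTW, hT, hcl⟩
      by_cases hvT : v ∈ T
      · refine Or.inr ⟨T.erase v, ?_, insert_erase hvT⟩
        intro u hu
        obtain ⟨huv, huT⟩ := mem_erase.1 hu
        exact mem_filter.2 ⟨(mem_insert.1 (hTW huT)).resolve_left huv, hcl hvT huT huv.symm⟩
      · exact Or.inl ⟨(subset_insert_iff_of_notMem hvT).1 hTW, hT, hcl⟩
    · rintro (⟨hTW, hT, hcl⟩ | ⟨U, hU, rfl⟩)
      · exact ⟨hTW.trans (subset_insert _ _), hT, hcl⟩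
      · refine ⟨insert_subset_insert _ (hU.trans (filter_subset _ _)), insert_nonempty _ _, ?_⟩
        rw [coe_insert]
        exact (hQ.subset (coe_subset.2 hU)).insert fun u hu _ => (mem_filter.1 (hU hu)).2
  · rw [disjoint_left]
    intro T hT hT'
    obtain ⟨U, -, rfl⟩ := mem_image.1 hT'
    exact hv ((mem_cliquesIn.1 hT).1 (mem_insert_self _ _))

theorem card_le_of_mem_cliquesIn [Finite V] {G : SimpleGraph V} {ω : ℕ} (hω : G.cliqueNum ≤ ω)
    {W T : Finset V} (hT : T ∈ cliquesIn G W) : T.card ≤ ω :=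
  (SimpleGraph.IsClique.card_le_cliqueNum (tc := (mem_cliquesIn.1 hT).2.2)).trans hω

open Classical in
/-- A chordal graph has only linearly many cliques. -/
theorem IsChordal.card_cliquesIn_le [Finite V] {G : SimpleGraph V} (hG : IsChordal G) {ω : ℕ}
    (hω : G.cliqueNum ≤ ω) (W : Finset V) : (cliquesIn G W).card ≤ W.card * 2 ^ ω := by
  induction W using hG.elimination_induction with
  | empty =>
    have : cliquesIn G ∅ = ∅ := by
      ext T
      simp only [mem_cliquesIn, subset_empty, notMem_empty, iff_false]
      rintro ⟨rfl, h, -⟩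
      simp at h
    simp [this]
  | insert W v hv hQ ih =>
    rw [card_eq_sum_ones, sum_cliquesIn_insert hv hQ, ← card_eq_sum_ones, ← card_eq_sum_ones,
      card_powerset, card_insert_of_notMem hv, add_mul, one_mul]
    refine Nat.add_le_add ih (Nat.pow_le_pow_right (by norm_num) ?_)
    exact (SimpleGraph.IsClique.card_le_cliqueNum (tc := hQ)).trans hω

open Classical in
/-- Induction along a perfect elimination order: a new simplicial vertex adds a component if it has
no neighbours, and otherwise joins the component of its neighbours. The vertices outside `W` are
counted as isolated ones. -/
theorem IsChordal.exists_isRep_spanned [Fintype V] {G : SimpleGraph V} (hG : IsChordal G)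
    (W : Finset V) : ∃ r : V → V, IsRep (spanned G W) r ∧
      ((#{v | r v = v} : ℕ) : ℝ) =
        (Fintype.card V - W.card) + ∑ T ∈ cliquesIn G W, (-1 : ℝ) ^ (T.card + 1) := by
  induction W using hG.elimination_induction with
  | empty =>
    refine ⟨id, ⟨fun u v h => absurd h.2.1 (by simp), fun v => .refl _⟩, ?_⟩
    have : cliquesIn G ∅ = ∅ := by
      ext T
      simp only [mem_cliquesIn, subset_empty, notMem_empty, iff_false]
      rintro ⟨rfl, h, -⟩
      simp at h
    simp [this]
  | insert W v hv hQ ih =>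
    obtain ⟨r, hr, hcount⟩ := ih
    set Q := W.filter (G.Adj v) with hQdef
    have hsum : ∑ U ∈ Q.powerset, (-1 : ℝ) ^ ((insert v U).card + 1) =
        ∑ U ∈ Q.powerset, (-1 : ℝ) ^ U.card := by
      refine sum_congr rfl fun U hU => ?_
      rw [card_insert_of_notMem fun h => hv (mem_filter.1 (mem_powerset.1 hU h)).1, pow_add, pow_add]
      norm_num
    rw [sum_cliquesIn_insert hv hQ, hsum, card_insert_of_notMem hv]
    have hmono : spanned G W ≤ spanned G (insert v W) := fun x y h =>
      ⟨h.1, mem_insert_of_mem h.2.1, mem_insert_of_mem h.2.2⟩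
    -- `v` is isolated in `spanned G W`, hence it represents itself and nothing else.
    have hiso : ∀ u, (spanned G W).Reachable v u → u = v := by
      intro u hu
      obtain ⟨p⟩ := hu
      cases p with
      | nil => rfl
      | cons h _ => exact absurd h.2.1 hv
    have hrv : r v = v := hiso _ (hr.reach v)
    have hru : ∀ u, r u = v → u = v := fun u hu => hiso u (hu ▸ (hr.reach u).symm)
    have hadj : ∀ a b, (spanned G (insert v W)).Adj a b → a ≠ v → b ≠ v →
        (spanned G W).Adj a b := fun a b h ha hb =>
      ⟨h.1, (mem_insert.1 h.2.1).resolve_left ha, (mem_insert.1 h.2.2).resolve_left hb⟩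
    have hadjQ : ∀ a, (spanned G (insert v W)).Adj v a → a ∈ Q := fun a h =>
      mem_filter.2 ⟨(mem_insert.1 h.2.2).resolve_left h.1.ne', h.1⟩
    rcases Q.eq_empty_or_nonempty with hQe | ⟨q, hq⟩
    · refine ⟨r, ⟨fun a b h => ?_, fun u => (hr.reach u).mono hmono⟩, ?_⟩
      · have ha : a ≠ v := by
          rintro rfl; simpa [hQe] using hadjQ b h
        have hb : b ≠ v := by
          rintro rfl; simpa [hQe] using hadjQ a h.symm
        exact hr.adj _ _ (hadj _ _ h ha hb)
      · rw [hcount, hQe]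
        simp
        ring
    · have hqW := mem_filter.1 hq
      have hqQ : ∀ a ∈ Q, r a = r q := by
        intro a ha
        by_cases haq : a = q
        · rw [haq]
        · exact hr.adj _ _ ⟨hQ ha hq haq, (mem_filter.1 ha).1, hqW.1⟩
      refine ⟨Function.update r v (r q), ⟨fun a b h => ?_, fun u => ?_⟩, ?_⟩
      · by_cases ha : a = v
        · subst ha
          rw [Function.update_self, Function.update_of_ne h.1.ne', hqQ b (hadjQ b h)]
        · by_cases hb : b = v
          · subst hb
            rw [Function.update_self, Function.update_of_ne ha, hqQ a (hadjQ a h.symm)]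
          · rw [Function.update_of_ne ha, Function.update_of_ne hb]
            exact hr.adj _ _ (hadj _ _ h ha hb)
      · by_cases hu : u = v
        · subst hu
          rw [Function.update_self]
          have : (spanned G (insert u W)).Adj u q :=
            ⟨hqW.2, mem_insert_self _ _, mem_insert_of_mem hqW.1⟩
          exact this.reachable.trans ((hr.reach q).mono hmono)
        · rw [Function.update_of_ne hu]
          exact (hr.reach u).mono hmono
      · have hqv : r q ≠ v := fun h => hv (hru q h ▸ hqW.1)
        have hset : ({u | r u = u} : Finset V) =
            insert v ({u | Function.update r v (r q) u = u} : Finset V) := by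
          ext u
          by_cases hu : u = v
          · subst hu; simp [hrv]
          · simp [hu]
        have hnot : v ∉ ({u | Function.update r v (r q) u = u} : Finset V) := by simp [hqv]
        rw [hset, card_insert_of_notMem hnot] at hcount
        have h0 : ∑ U ∈ Q.powerset, (-1 : ℝ) ^ U.card = 0 := by
          have := sum_powerset_neg_one_pow_card_of_nonempty ⟨q, hq⟩
          exact_mod_cast this
        rw [h0]
        push_cast at hcount ⊢
        linarith

/-- In a chordal graph the number of connected components is the alternating sum of the numbers of
cliques of each size. -/
theorem IsChordal.cc_eq_sum_cliquesIn [Fintype V] {G : SimpleGraph V} (hG : IsChordal G) :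
    (cc G : ℝ) = ∑ T ∈ cliquesIn G univ, (-1 : ℝ) ^ (T.card + 1) := by
  classical
  obtain ⟨r, hr, hcount⟩ := hG.exists_isRep_spanned univ
  have : spanned G univ = G := by ext; simp [spanned]
  rw [this] at hr
  rw [hr.cc_eq, hcount, card_univ]
  ring

open Classical in
/-- The number of cliques with at least two vertices through a given vertex is linear in the
maximum degree: removing the vertex leaves a clique of its neighbourhood. -/
theorem IsChordal.card_cliques_through_le [Fintype V] {G : SimpleGraph V} (hG : IsChordal G)
    {ω d : ℕ} (hω : G.cliqueNum ≤ ω) (hd : G.maxDegree ≤ d) (v : V) :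
    ((cliquesIn G univ).filter fun T => v ∈ T ∧ 2 ≤ T.card).card ≤ d * 2 ^ ω := by
  calc _ ≤ (cliquesIn G (G.neighborFinset v)).card := by
        refine card_le_card_of_injOn (fun T => T.erase v) ?_ ?_
        · intro T hT
          obtain ⟨hT, hvT, hT2⟩ := mem_filter.1 (mem_coe.1 hT)
          obtain ⟨-, -, hcl⟩ := mem_cliquesIn.1 hT
          refine mem_coe.2 (mem_cliquesIn.2 ⟨?_, ?_, ?_⟩)
          · intro u hu
            obtain ⟨huv, huT⟩ := mem_erase.1 hu
            exact (G.mem_neighborFinset v u).2 (hcl hvT huT huv.symm)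
          · rw [← card_pos, card_erase_of_mem hvT]; omega
          · exact hcl.subset (coe_subset.2 (erase_subset _ _))
        · intro A hA B hB hAB
          have hA' := (mem_filter.1 (mem_coe.1 hA)).2.1
          have hB' := (mem_filter.1 (mem_coe.1 hB)).2.1
          simp only at hAB
          rw [← insert_erase hA', hAB, insert_erase hB']
    _ ≤ (G.neighborFinset v).card * 2 ^ ω := hG.card_cliquesIn_le hω _
    _ ≤ d * 2 ^ ω := by
        gcongr
        rw [G.card_neighborFinset_eq_degree]
        exact (G.degree_le_maxDegree v).trans hd

open Classical in
/-- The number of ordered pairs of different cliques with a common vertex is linear in the number of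
vertices times the maximum degree. -/
theorem IsChordal.card_meeting_cliques_le [Fintype V] {G : SimpleGraph V} (hG : IsChordal G)
    {ω d : ℕ} (hω : G.cliqueNum ≤ ω) (hd : G.maxDegree ≤ d) :
    ((cliquesIn G univ ×ˢ cliquesIn G univ).filter
        fun P => P.1 ≠ P.2 ∧ (P.1 ∩ P.2).Nonempty).card ≤
      2 * (Fintype.card V * 2 ^ ω * (ω * (d * 2 ^ ω))) := by
  set K := cliquesIn G univ with hK
  have hone : ((K ×ˢ K).filter fun P => (P.1 ∩ P.2).Nonempty ∧ 2 ≤ P.2.card).card ≤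
      Fintype.card V * 2 ^ ω * (ω * (d * 2 ^ ω)) := by
    calc _ ≤ (K.sigma fun T => T.biUnion fun v => K.filter fun T' => v ∈ T' ∧ 2 ≤ T'.card).card := by
          refine card_le_card_of_injOn (fun P => ⟨P.1, P.2⟩) ?_ ?_
          · rintro ⟨A, B⟩ hP
            obtain ⟨hP, ⟨v, hv⟩, h2⟩ := mem_filter.1 (mem_coe.1 hP)
            obtain ⟨hA, hB⟩ := mem_product.1 hP
            obtain ⟨hvA, hvB⟩ := mem_inter.1 hv
            exact mem_coe.2 (mem_sigma.2 ⟨hA, mem_biUnion.2 ⟨v, hvA, mem_filter.2 ⟨hB, hvB, h2⟩⟩⟩)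
          · rintro ⟨A, B⟩ - ⟨A', B'⟩ - h
            simpa using h
      _ = ∑ T ∈ K, (T.biUnion fun v => K.filter fun T' => v ∈ T' ∧ 2 ≤ T'.card).card :=
          card_sigma _ _
      _ ≤ ∑ _T ∈ K, ω * (d * 2 ^ ω) := by
          refine sum_le_sum fun T hT => (card_biUnion_le_card_mul _ _ (d * 2 ^ ω) fun v _ =>
            hG.card_cliques_through_le hω hd v).trans ?_
          exact Nat.mul_le_mul_right _ (card_le_of_mem_cliquesIn hω hT)
      _ = K.card * (ω * (d * 2 ^ ω)) := by rw [sum_const, smul_eq_mul]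
      _ ≤ _ := by
          gcongr
          exact hG.card_cliquesIn_le hω _
  have hswap : ((K ×ˢ K).filter fun P => (P.1 ∩ P.2).Nonempty ∧ 2 ≤ P.1.card).card ≤
      Fintype.card V * 2 ^ ω * (ω * (d * 2 ^ ω)) := by
    refine le_trans (card_le_card_of_injOn Prod.swap ?_ Prod.swap_injective.injOn) hone
    rintro ⟨A, B⟩ hP
    simp only [coe_filter, mem_product, Set.mem_ofPred_eq, Prod.swap_prod_mk] at hP ⊢
    rw [inter_comm]
    tauto
  rw [two_mul]
  refine (card_le_card ?_).trans ((card_union_le _ _).trans (Nat.add_le_add hone hswap))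
  rintro ⟨A, B⟩ hP
  simp only [mem_filter, mem_product, mem_union] at hP ⊢
  obtain ⟨⟨hA, hB⟩, hne, hAB⟩ := hP
  -- Two different cliques that meet cannot both be singletons.
  have : 2 ≤ B.card ∨ 2 ≤ A.card := by
    by_contra! h
    obtain ⟨v, hv⟩ := hAB
    obtain ⟨hvA, hvB⟩ := mem_inter.1 hv
    have h1 : ∀ x ∈ A, x = v := fun x hx => card_le_one.1 (by omega) x hx v hvA
    have h2 : ∀ x ∈ B, x = v := fun x hx => card_le_one.1 (by omega) x hx v hvB
    exact hne (by
      rw [eq_singleton_iff_unique_mem.2 ⟨hvA, h1⟩, eq_singleton_iff_unique_mem.2 ⟨hvB, h2⟩])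
  tauto

end Cliques

/-! ### Bernoulli sampling -/

section Sampling

variable {N : ℕ}

theorem sampleProb_nonneg {p : ℝ} (hp : 0 ≤ p) (hp1 : p ≤ 1) (S : Finset (Fin N)) :
    0 ≤ sampleProb p S :=
  mul_nonneg (pow_nonneg hp _) (pow_nonneg (sub_nonneg.2 hp1) _)

/-- The vertices of `T` are all sampled with probability `p ^ T.card`. -/
theorem sum_sampleProb_superset (p : ℝ) (T : Finset (Fin N)) :
    ∑ S : Finset (Fin N), (if T ⊆ S then sampleProb p S else 0) = p ^ T.card := by
  have h := prod_add (fun _ : Fin N => p) (fun i => if i ∈ T then 0 else 1 - p) univ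
  rw [powerset_univ] at h
  have hl : ∏ i : Fin N, (p + if i ∈ T then 0 else 1 - p) = p ^ T.card := by
    rw [← prod_const, ← prod_subset (subset_univ T) (f := fun i => p + if i ∈ T then 0 else 1 - p)]
    · exact prod_congr rfl fun i hi => by simp [hi]
    · intro i _ hi; simp [hi]
  rw [← hl, h]
  refine sum_congr rfl fun S _ => ?_
  rw [prod_const]
  split_ifs with hTS
  · rw [sampleProb, prod_congr rfl (g := fun _ => 1 - p), prod_const, card_sdiff_of_subset
      (subset_univ S), card_univ, Fintype.card_fin]
    intro i hi
    rw [if_neg fun hiT => (mem_sdiff.1 hi).2 (hTS hiT)]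
  · obtain ⟨i, hiT, hiS⟩ := not_subset.1 hTS
    rw [prod_eq_zero (i := i) (by simp [hiS]) (by simp [hiT]), mul_zero]

theorem sum_sampleProb (p : ℝ) : ∑ S : Finset (Fin N), sampleProb p S = 1 := by
  simpa using sum_sampleProb_superset p (∅ : Finset (Fin N))

/-- The normalised indicators of the events `T ⊆ S` and `T' ⊆ S` have covariance
`p⁻¹ ^ (T ∩ T').card - 1`. -/
theorem covariance_indicator {p : ℝ} (hp : p ≠ 0) (T T' : Finset (Fin N)) :
    ∑ S : Finset (Fin N), sampleProb p S *
        (((if T ⊆ S then p⁻¹ ^ T.card else 0) - 1) * ((if T' ⊆ S then p⁻¹ ^ T'.card else 0) - 1)) =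
      p⁻¹ ^ (T ∩ T').card - 1 := by
  have hexp : ∀ S : Finset (Fin N), sampleProb p S *
      (((if T ⊆ S then p⁻¹ ^ T.card else 0) - 1) * ((if T' ⊆ S then p⁻¹ ^ T'.card else 0) - 1)) =
      p⁻¹ ^ T.card * p⁻¹ ^ T'.card * (if T ∪ T' ⊆ S then sampleProb p S else 0)
        - p⁻¹ ^ T.card * (if T ⊆ S then sampleProb p S else 0)
        - p⁻¹ ^ T'.card * (if T' ⊆ S then sampleProb p S else 0) + sampleProb p S := by
    intro S
    by_cases h : T ⊆ S <;> by_cases h' : T' ⊆ S <;> simp [h, h', union_subset_iff] <;> ring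
  rw [sum_congr rfl fun S _ => hexp S, sum_add_distrib, sum_sub_distrib, sum_sub_distrib,
    ← mul_sum, ← mul_sum, ← mul_sum, sum_sampleProb_superset, sum_sampleProb_superset,
    sum_sampleProb_superset, sum_sampleProb]
  have h1 : ∀ n : ℕ, p⁻¹ ^ n * p ^ n = 1 := fun n => by
    rw [← mul_pow, inv_mul_cancel₀ hp, one_pow]
  have hcard := card_union_add_card_inter T T'
  have h2 : p⁻¹ ^ T.card * p⁻¹ ^ T'.card * p ^ (T ∪ T').card = p⁻¹ ^ (T ∩ T').card := by
    rw [← pow_add, ← hcard, pow_add]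
    linear_combination p⁻¹ ^ (T ∩ T').card * h1 (T ∪ T').card
  rw [h1, h1, h2]
  ring

end Sampling

/-! ### The clique-counting estimator and the upper bound -/

section UpperBound

variable {N : ℕ}

/-- The Horvitz–Thompson estimator: every nonempty clique `T` of the sampled graph, which has been
observed with probability `p ^ T.card`, is counted with weight `± p⁻¹ ^ T.card`. -/
noncomputable def cliqueEstimator (N : ℕ) (p : ℝ) : Estimator N := fun S g =>
  ∑ T ∈ cliquesIn (g.map (Function.Embedding.subtype (· ∈ S))) S,
    (-1) ^ (T.card + 1) * p⁻¹ ^ T.card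

theorem cliquesIn_map_sampled (G : SimpleGraph (Fin N)) (S : Finset (Fin N)) :
    cliquesIn ((sampled G S).map (Function.Embedding.subtype (· ∈ S))) S = cliquesIn G S := by
  ext T
  rw [mem_cliquesIn, mem_cliquesIn]
  refine and_congr_right fun hTS => and_congr_right fun _ => ?_
  constructor
  · intro h u hu v hv huv
    obtain ⟨-, a, b, hab, rfl, rfl⟩ := h hu hv huv
    exact hab
  · intro h u hu v hv huv
    exact ⟨huv, ⟨u, hTS hu⟩, ⟨v, hTS hv⟩, h hu hv huv, rfl, rfl⟩

theorem cliqueEstimator_sampled (p : ℝ) (G : SimpleGraph (Fin N)) (S : Finset (Fin N)) :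
    cliqueEstimator N p S (sampled G S) =
      ∑ T ∈ cliquesIn G univ, (-1) ^ (T.card + 1) * (if T ⊆ S then p⁻¹ ^ T.card else 0) := by
  classical
  rw [cliqueEstimator, cliquesIn_map_sampled]
  have : cliquesIn G S = (cliquesIn G univ).filter (· ⊆ S) := by
    ext T; simp [mem_cliquesIn, and_comm]
  rw [this, sum_filter]
  exact sum_congr rfl fun T _ => by split_ifs <;> simp

/-- The estimator is unbiased, and its variance is a sum of covariances over pairs of cliques. -/
theorem mse_cliqueEstimator_eq {p : ℝ} (hp : p ≠ 0) {G : SimpleGraph (Fin N)} (hG : IsChordal G) :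
    mse p (cliqueEstimator N p) G = ∑ T ∈ cliquesIn G univ, ∑ T' ∈ cliquesIn G univ,
      (-1) ^ (T.card + 1) * (-1) ^ (T'.card + 1) * (p⁻¹ ^ (T ∩ T').card - 1) := by
  have h : ∀ S : Finset (Fin N),
      sampleProb p S * (cliqueEstimator N p S (sampled G S) - (cc G : ℝ)) ^ 2 =
      ∑ T ∈ cliquesIn G univ, ∑ T' ∈ cliquesIn G univ, (-1) ^ (T.card + 1) * (-1) ^ (T'.card + 1) *
        (sampleProb p S * (((if T ⊆ S then p⁻¹ ^ T.card else 0) - 1) *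
          ((if T' ⊆ S then p⁻¹ ^ T'.card else 0) - 1))) := by
    intro S
    rw [cliqueEstimator_sampled, hG.cc_eq_sum_cliquesIn, ← sum_sub_distrib, sq, sum_mul_sum, mul_sum]
    refine sum_congr rfl fun T _ => ?_
    rw [mul_sum]
    refine sum_congr rfl fun T' _ => ?_
    ring
  rw [mse, sum_congr rfl fun S _ => h S, sum_comm]
  refine sum_congr rfl fun T _ => ?_
  rw [sum_comm]
  refine sum_congr rfl fun T' _ => ?_
  rw [← mul_sum, covariance_indicator hp]

/-- The diagonal contributes `N / p ^ ω`. Off the diagonal only pairs of different cliques that meet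
contribute; there are `O(N d)` of them, with intersections of at most `ω - 1` vertices. -/
theorem mse_cliqueEstimator_le {p : ℝ} (hp : 0 < p) (hp1 : p ≤ 1) {d ω : ℕ} (hω : 2 ≤ ω)
    {G : SimpleGraph (Fin N)} (hG : G ∈ chordalClass N d ω) :
    mse p (cliqueEstimator N p) G ≤
      2 ^ ω * (N / p ^ ω) + 2 * 2 ^ ω * (ω * 2 ^ ω) * (N * d / p ^ (ω - 1)) := by
  classical
  obtain ⟨hch, hd, hcl⟩ := hG
  set K := cliquesIn G univ with hK
  have hq : 1 ≤ p⁻¹ := (one_le_inv₀ hp).2 hp1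
  have hterm : ∀ T ∈ K, ∀ T' ∈ K,
      (-1) ^ (T.card + 1) * (-1) ^ (T'.card + 1) * (p⁻¹ ^ (T ∩ T').card - 1) ≤
        (if T = T' then p⁻¹ ^ ω else 0) +
          (if T ≠ T' ∧ (T ∩ T').Nonempty then p⁻¹ ^ (ω - 1) else 0) := by
    intro T hT T' hT'
    have hTω := card_le_of_mem_cliquesIn hcl hT
    have hTω' := card_le_of_mem_cliquesIn hcl hT'
    have h1 : (-1) ^ (T.card + 1) * (-1) ^ (T'.card + 1) * (p⁻¹ ^ (T ∩ T').card - 1) ≤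
        p⁻¹ ^ (T ∩ T').card - 1 := by
      have h0 : 0 ≤ p⁻¹ ^ (T ∩ T').card - 1 := sub_nonneg.2 (one_le_pow₀ hq)
      rw [← pow_add]
      rcases neg_one_pow_eq_or ℝ (T.card + 1 + (T'.card + 1)) with h | h <;> rw [h] <;> linarith
    refine h1.trans ?_
    by_cases hTT : T = T'
    · subst hTT
      simp only [inter_self, ne_eq, not_true_eq_false, false_and, if_true, if_false]
      have := pow_le_pow_right₀ hq hTω
      linarith
    · by_cases hne : (T ∩ T').Nonempty
      · have hlt : (T ∩ T').card ≤ ω - 1 := by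
          rcases eq_or_ssubset_of_subset (inter_subset_left (s₁ := T) (s₂ := T')) with h | h
          · have : T ⊂ T' := (inter_eq_left.1 h).ssubset_of_ne hTT
            have := card_lt_card this
            rw [h]; omega
          · have := card_lt_card h
            omega
        have := pow_le_pow_right₀ hq hlt
        simp only [hTT, hne, ne_eq, not_false_eq_true, and_self, if_true, if_false]
        linarith
      · simp [hTT, not_nonempty_iff_eq_empty.1 hne]
  have hKcard : (K.card : ℝ) ≤ N * 2 ^ ω := by
    have := hch.card_cliquesIn_le hcl univ
    rw [card_univ, Fintype.card_fin] at this
    exact_mod_cast this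
  have hpairs : ((((K ×ˢ K).filter fun P => P.1 ≠ P.2 ∧ (P.1 ∩ P.2).Nonempty).card : ℕ) : ℝ) ≤
      2 * (N * 2 ^ ω * (ω * (d * 2 ^ ω))) := by
    have := hch.card_meeting_cliques_le hcl hd
    rw [Fintype.card_fin] at this
    have h : ((K ×ˢ K).filter fun P => P.1 ≠ P.2 ∧ (P.1 ∩ P.2).Nonempty).card ≤
        2 * (N * 2 ^ ω * (ω * (d * 2 ^ ω))) := by convert this
    exact_mod_cast h
  rw [mse_cliqueEstimator_eq hp.ne' hch]
  calc _ ≤ ∑ T ∈ K, ∑ T' ∈ K, ((if T = T' then p⁻¹ ^ ω else 0) +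
          (if T ≠ T' ∧ (T ∩ T').Nonempty then p⁻¹ ^ (ω - 1) else 0)) :=
        sum_le_sum fun T hT => sum_le_sum fun T' hT' => hterm T hT T' hT'
    _ = K.card * p⁻¹ ^ ω +
        ((K ×ˢ K).filter fun P => P.1 ≠ P.2 ∧ (P.1 ∩ P.2).Nonempty).card * p⁻¹ ^ (ω - 1) := by
        simp only [sum_add_distrib]
        congr 1
        · rw [← nsmul_eq_mul, ← sum_const]
          exact sum_congr rfl fun T hT => by simp [hT]
        · rw [← sum_product' K K
            (f := fun T T' => if T ≠ T' ∧ (T ∩ T').Nonempty then p⁻¹ ^ (ω - 1) else 0),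
            ← sum_filter, sum_const, nsmul_eq_mul]
    _ ≤ (N * 2 ^ ω) * p⁻¹ ^ ω + (2 * (N * 2 ^ ω * (ω * (d * 2 ^ ω)))) * p⁻¹ ^ (ω - 1) := by
        gcongr
    _ = _ := by
        rw [inv_pow, inv_pow]
        ring

theorem cc_le (G : SimpleGraph (Fin N)) : cc G ≤ N := by
  have := Nat.card_le_card_of_surjective G.connectedComponentMk Quot.mk_surjective
  simpa [cc] using this

theorem minimaxMSE_le_of_forall {d ω : ℕ} {p B : ℝ} (f : Estimator N)
    (h : ∀ G ∈ chordalClass N d ω, mse p f G ≤ B) : minimaxMSE N d ω p ≤ ENNReal.ofReal B :=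
  (iInf_le _ f).trans (iSup₂_le fun G hG => ENNReal.ofReal_le_ofReal (h G hG))

theorem minimaxMSE_le_rate (d : ℕ) {ω : ℕ} (hω : 2 ≤ ω) {p : ℝ} (hp : 0 < p) (hp1 : p ≤ 1) :
    minimaxMSE N d ω p ≤
      ENNReal.ofReal ((2 ^ ω + 2 * 2 ^ ω * (ω * 2 ^ ω)) * rate N d ω p) := by
  rcases le_total (max ((N : ℝ) / p ^ ω) ((N : ℝ) * d / p ^ (ω - 1))) ((N : ℝ) ^ 2) with h | h
  · rw [rate, min_eq_left h]
    refine minimaxMSE_le_of_forall (cliqueEstimator N p) fun G hG =>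
      (mse_cliqueEstimator_le hp hp1 hω hG).trans ?_
    rw [add_mul]
    gcongr
    · exact le_max_left _ _
    · exact le_max_right _ _
  · rw [rate, min_eq_right h]
    refine minimaxMSE_le_of_forall (fun _ _ => 0) fun G _ => ?_
    have hcc : (cc G : ℝ) ^ 2 ≤ (N : ℝ) ^ 2 := by
      have := cc_le G
      gcongr
    have h1 : mse p (fun _ _ => 0) G = (cc G : ℝ) ^ 2 := by
      simp only [mse, zero_sub, neg_sq]
      rw [← sum_mul, sum_sampleProb, one_mul]
    rw [h1]
    have h2 : (1 : ℝ) ≤ 2 ^ ω := one_le_pow₀ (by norm_num)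
    have h3 : (0 : ℝ) ≤ 2 * 2 ^ ω * (ω * 2 ^ ω) := by positivity
    nlinarith [sq_nonneg (N : ℝ)]

end UpperBound

/-! ### Random bits with biased parities -/

section Bits

variable {M k : ℕ}

/-- The parity sign of a bit vector: `1` if the number of ones is even and `-1` if it is odd. -/
def paritySign (y : Fin k → Bool) : ℝ := ∏ i, if y i then -1 else 1

theorem paritySign_sq (y : Fin k → Bool) : paritySign y ^ 2 = 1 := by
  rw [paritySign, ← prod_pow]
  exact prod_eq_one fun i _ => by split_ifs <;> norm_num

theorem abs_paritySign (y : Fin k → Bool) : |paritySign y| = 1 := by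
  rw [← sq_eq_sq₀ (abs_nonneg _) zero_le_one, sq_abs, paritySign_sq, one_pow]

/-- Negation of the bit number `i` of the block `b`. -/
def flipBit (b : Fin M) (i : Fin k) (x : Fin M → Fin k → Bool) : Fin M → Fin k → Bool :=
  Function.update x b (Function.update (x b) i (!x b i))

theorem flipBit_involutive (b : Fin M) (i : Fin k) : Function.Involutive (flipBit b i) := by
  intro x
  simp [flipBit]

theorem flipBit_of_ne {b b' : Fin M} (h : b' ≠ b) (i : Fin k) (x : Fin M → Fin k → Bool) :
    flipBit b i x b' = x b' :=
  Function.update_of_ne h _ _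

theorem flipBit_apply_of_ne {b b' : Fin M} {i i' : Fin k} (h : (b', i') ≠ (b, i))
    (x : Fin M → Fin k → Bool) : flipBit b i x b' i' = x b' i' := by
  by_cases hb : b' = b
  · subst hb
    have hi : i' ≠ i := fun hi => h (by rw [hi])
    simp [flipBit, Function.update_of_ne hi]
  · rw [flipBit_of_ne hb]

theorem paritySign_flipBit (b : Fin M) (i : Fin k) (x : Fin M → Fin k → Bool) :
    paritySign (flipBit b i x b) = -paritySign (x b) := by
  simp only [paritySign]
  rw [← mul_prod_erase univ _ (mem_univ i), ← mul_prod_erase univ _ (mem_univ i), ← neg_mul]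
  congr 1
  · cases h : x b i <;> simp [flipBit, h]
  · refine prod_congr rfl fun j hj => ?_
    rw [flipBit_apply_of_ne]
    simpa using ne_of_mem_erase hj

/-- A function that does not see one of the bits of the block `b` is uncorrelated with the parity of
that block. -/
theorem sum_mul_paritySign_eq_zero {b : Fin M} {i : Fin k} {h : (Fin M → Fin k → Bool) → ℝ}
    (hh : ∀ x, h (flipBit b i x) = h x) : ∑ x, h x * paritySign (x b) = 0 := by
  have := Equiv.sum_comp (flipBit_involutive b i).toPerm fun x => h x * paritySign (x b)
  simp only [Function.Involutive.coe_toPerm, hh, paritySign_flipBit, mul_neg, sum_neg_distrib]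
    at this
  linarith

/-- The density, with respect to the uniform distribution on bit arrays, of the distribution that
gives the parity of each block in `A`, independently, the bias `e`. -/
def tilt (e : ℝ) (A : Finset (Fin M)) (x : Fin M → Fin k → Bool) : ℝ :=
  ∏ b ∈ A, (1 + e * paritySign (x b))

theorem tilt_nonneg {e : ℝ} (h0 : 0 ≤ e) (h1 : e ≤ 1) (A : Finset (Fin M))
    (x : Fin M → Fin k → Bool) : 0 ≤ tilt e A x := by
  refine prod_nonneg fun b _ => ?_
  have := neg_abs_le (e * paritySign (x b))
  rw [abs_mul, abs_paritySign, abs_of_nonneg h0] at this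
  linarith

/-- Blocks in which `h` overlooks some bit may be dropped from the tilt. -/
theorem sum_mul_tilt_union (e : ℝ) {h : (Fin M → Fin k → Bool) → ℝ} (A B : Finset (Fin M))
    (hh : ∀ b ∈ A, b ∉ B → ∃ i, ∀ x, h (flipBit b i x) = h x) :
    ∑ x, h x * tilt e (A ∪ B) x = ∑ x, h x * tilt e B x := by
  induction A using Finset.induction_on with
  | empty => simp
  | insert b A hbA ih =>
    rw [← ih fun b' hb' => hh b' (mem_insert_of_mem hb'), insert_union]
    by_cases hb : b ∈ A ∪ B
    · rw [insert_eq_of_mem hb]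
    · have hbB : b ∉ B := fun h => hb (mem_union_right _ h)
      obtain ⟨i, hi⟩ := hh b (mem_insert_self _ _) hbB
      have hinv : ∀ x, tilt e (A ∪ B) (flipBit b i x) = tilt e (A ∪ B) x := fun x =>
        prod_congr rfl fun b' hb' => by
          rw [flipBit_of_ne (ne_of_mem_of_not_mem hb' hb)]
      have h0 := sum_mul_paritySign_eq_zero (b := b) (i := i)
        (h := fun x => h x * tilt e (A ∪ B) x) fun x => by rw [hi, hinv]
      have : ∀ x, h x * tilt e (insert b (A ∪ B)) x = h x * tilt e (A ∪ B) x +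
          e * (h x * tilt e (A ∪ B) x * paritySign (x b)) := fun x => by
        rw [tilt, prod_insert hb, ← tilt]; ring
      simp only [this, sum_add_distrib, ← mul_sum, h0, mul_zero, add_zero]

theorem sum_mul_tilt_univ (e : ℝ) {h : (Fin M → Fin k → Bool) → ℝ} (B : Finset (Fin M))
    (hh : ∀ b, b ∉ B → ∃ i, ∀ x, h (flipBit b i x) = h x) :
    ∑ x, h x * tilt e univ x = ∑ x, h x * tilt e B x := by
  rw [← sum_mul_tilt_union e univ B fun b _ => hh b, union_eq_left.2 (subset_univ B)]

theorem sum_tilt (hk : 0 < k) (e : ℝ) (B : Finset (Fin M)) :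
    ∑ x : Fin M → Fin k → Bool, tilt e B x = (2 ^ k) ^ M := by
  have := sum_mul_tilt_union (M := M) (k := k) e (h := fun _ => 1) B ∅
    fun b _ _ => ⟨⟨0, hk⟩, fun _ => rfl⟩
  simpa [tilt] using this

theorem sum_tilt_sq (hk : 0 < k) (e : ℝ) (B : Finset (Fin M)) :
    ∑ x : Fin M → Fin k → Bool, tilt e B x ^ 2 = (1 + e ^ 2) ^ B.card * (2 ^ k) ^ M := by
  have h : ∀ x : Fin M → Fin k → Bool,
      tilt e B x ^ 2 = (1 + e ^ 2) ^ B.card * tilt (2 * e / (1 + e ^ 2)) B x := by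
    intro x
    rw [tilt, tilt, ← prod_pow, ← prod_const, ← prod_mul_distrib]
    refine prod_congr rfl fun b _ => ?_
    have h1 := paritySign_sq (x b)
    field_simp
    linear_combination e ^ 2 * h1
  simp only [h, ← mul_sum, sum_tilt hk]

/-- Against the two tilts, a sum of functions of single blocks differs by the correlation of these
functions with the parity, once for each block that is tilted in only one of them. -/
theorem sum_blockSum_mul_tilt_sub (hk : 0 < k) (e c : ℝ) (κ : (Fin k → Bool) → ℝ)
    (B : Finset (Fin M)) :
    ∑ x : Fin M → Fin k → Bool, (c + ∑ b, κ (x b)) * (tilt e univ x - tilt e B x) =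
      (M - B.card) * (e * ((2 ^ k) ^ M * ((∑ y, κ y * paritySign y) / 2 ^ k))) := by
  have hconst : ∑ x : Fin M → Fin k → Bool, c * (tilt e univ x - tilt e B x) = 0 := by
    rw [← mul_sum, sum_sub_distrib, sum_tilt hk, sum_tilt hk, sub_self, mul_zero]
  have hblock : ∀ b : Fin M, ∑ x : Fin M → Fin k → Bool,
      κ (x b) * (tilt e univ x - tilt e B x) =
      if b ∈ B then 0 else e * ((2 ^ k) ^ M * ((∑ y, κ y * paritySign y) / 2 ^ k)) := by
    intro b
    have hinv : ∀ b', b' ≠ b → ∃ i, ∀ x : Fin M → Fin k → Bool,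
        κ (flipBit b' i x b) = κ (x b) := fun b' hb' =>
      ⟨⟨0, hk⟩, fun x => by rw [flipBit_of_ne hb'.symm]⟩
    simp only [mul_sub, sum_sub_distrib]
    split_ifs with hb
    · rw [sum_mul_tilt_univ e (h := fun x => κ (x b)) B fun b' hb' =>
        hinv b' fun h => hb' (h ▸ hb), sub_self]
    · have h1 := sum_mul_tilt_univ e (h := fun x : Fin M → Fin k → Bool => κ (x b)) {b}
        fun b' hb' => hinv b' (by simpa using hb')
      have h2 := sum_mul_tilt_union e (h := fun x : Fin M → Fin k → Bool => κ (x b)) B ∅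
        fun b' hb' _ => hinv b' fun h => hb (h ▸ hb')
      rw [union_empty] at h2
      rw [h1, h2, ← sum_sub_distrib]
      have h3 := Fintype.sum_piFinset_apply (ι := Fin M)
        (fun y : Fin k → Bool => κ y * paritySign y) univ b
      rw [Fintype.piFinset_univ, card_univ, Fintype.card_fun, Fintype.card_fin, Fintype.card_fin,
        Fintype.card_bool, nsmul_eq_mul] at h3
      have hM : M - 1 + 1 = M := Nat.sub_add_cancel (Fin.pos b)
      simp only [tilt, prod_singleton, prod_empty]
      calc _ = e * ∑ x : Fin M → Fin k → Bool, κ (x b) * paritySign (x b) := by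
            rw [mul_sum]; exact sum_congr rfl fun x _ => by ring
        _ = _ := by
            rw [h3, ← hM, pow_succ]
            push_cast
            field_simp
  simp only [add_mul, sum_add_distrib, hconst, zero_add, sum_mul]
  rw [sum_comm, sum_congr rfl fun b _ => hblock b, sum_ite, sum_const_zero, zero_add, sum_const,
    nsmul_eq_mul, filter_not, filter_mem_eq_inter, univ_inter, card_sdiff_of_subset (subset_univ B),
    Nat.cast_sub (card_le_card (subset_univ B)), card_univ, Fintype.card_fin]

/-- A comparison of the uniform prior with the tilted one, for a function `F` that overlooks
some bit of every block outside `B`. If `F` were close to `c + ∑ b, κ (x b)` under both priors, then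
it would have to follow the shift of this sum in the blocks outside `B`, which it cannot see. -/
theorem sq_shift_le (hk : 0 < k) {e : ℝ} (he0 : 0 ≤ e) (he1 : e ≤ 1) (c : ℝ)
    (κ : (Fin k → Bool) → ℝ) (B : Finset (Fin M)) {F : (Fin M → Fin k → Bool) → ℝ}
    (hF : ∀ b, b ∉ B → ∃ i, ∀ x, F (flipBit b i x) = F x) :
    (e * ((∑ y, κ y * paritySign y) / 2 ^ k) * (M - B.card)) ^ 2 * (2 ^ k) ^ M ≤
      ∑ x, (2 * tilt e univ x + 2 * (1 + e ^ 2) ^ B.card) * (F x - (c + ∑ b, κ (x b))) ^ 2 := by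
  set lam := (∑ y, κ y * paritySign y) / 2 ^ k with hlam
  set n : ℝ := (2 ^ k) ^ M with hn
  have hn0 : 0 < n := by positivity
  set D := fun x : Fin M → Fin k → Bool => F x - (c + ∑ b, κ (x b)) with hD
  have hsplit : ∑ x, D x * tilt e univ x - ∑ x, D x * tilt e B x = -(e * lam * (M - B.card) * n) := by
    have h1 := sum_mul_tilt_univ e B hF
    have h2 := sum_blockSum_mul_tilt_sub hk e c κ B
    simp only [mul_sub, sum_sub_distrib] at h2
    simp only [hD, sub_mul, sum_sub_distrib, h1]
    linear_combination -h2
  have hW : (∑ x, D x * tilt e univ x) ^ 2 ≤ (∑ x, D x ^ 2 * tilt e univ x) * n := by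
    rw [hn, ← sum_tilt hk e univ]
    refine sum_sq_le_sum_mul_sum_of_sq_le_mul _ (fun x _ => ?_) (fun x _ => ?_) fun x _ => le_of_eq ?_
    · exact mul_nonneg (sq_nonneg _) (tilt_nonneg he0 he1 _ _)
    · exact tilt_nonneg he0 he1 _ _
    · ring
  have hL : (∑ x, D x * tilt e B x) ^ 2 ≤ (∑ x, D x ^ 2) * ((1 + e ^ 2) ^ B.card * n) := by
    rw [hn, ← sum_tilt_sq hk e B]
    exact sum_mul_sq_le_sq_mul_sq _ _ _
  have hmain : (e * lam * (M - B.card) * n) ^ 2 ≤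
      2 * ((∑ x, D x ^ 2 * tilt e univ x) * n) +
        2 * ((∑ x, D x ^ 2) * ((1 + e ^ 2) ^ B.card * n)) := by
    have : e * lam * (M - B.card) * n = ∑ x, D x * tilt e B x - ∑ x, D x * tilt e univ x := by
      linarith
    rw [this]
    nlinarith [sq_nonneg (∑ x, D x * tilt e B x + ∑ x, D x * tilt e univ x)]
  have hrhs : ∑ x, (2 * tilt e univ x + 2 * (1 + e ^ 2) ^ B.card) * D x ^ 2 =
      2 * (∑ x, D x ^ 2 * tilt e univ x) + 2 * (1 + e ^ 2) ^ B.card * ∑ x, D x ^ 2 := by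
    rw [mul_sum, mul_sum, ← sum_add_distrib]
    exact sum_congr rfl fun x _ => by ring
  rw [hrhs]
  refine le_of_mul_le_mul_right ?_ hn0
  calc _ = (e * lam * (M - B.card) * n) ^ 2 := by ring
    _ ≤ _ := hmain
    _ = _ := by ring

end Bits

/-! ### The block graphs -/

section BlockGraph

variable {M k m r : ℕ}

/-- The vertices of the block graphs: `M` blocks, each with `k` core vertices and `m` leaves, and
`r` further vertices. -/
abbrev BlockVertex (M k m r : ℕ) : Type := (Fin M × (Fin k ⊕ Fin m)) ⊕ Fin r

/-- The block of a vertex, or `none` for the vertices which are kept isolated: the core vertices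
whose bit is `false`, and the vertices outside the blocks. -/
def activeBlock (x : Fin M → Fin k → Bool) : BlockVertex M k m r → Option (Fin M)
  | .inl (b, .inl i) => if x b i then some b else none
  | .inl (b, .inr _) => some b
  | .inr _ => none

/-- The leaves of the blocks. -/
def IsLeaf : BlockVertex M k m r → Prop
  | .inl (_, .inr _) => True
  | _ => False

/-- In each block, the core vertices whose bit is `true` form a clique, which is completely joined
to the independent set of the leaves. All other vertices are isolated. -/
def blockGraph (m r : ℕ) (x : Fin M → Fin k → Bool) : SimpleGraph (BlockVertex M k m r) where
  Adj u v := u ≠ v ∧ activeBlock x u ≠ none ∧ activeBlock x u = activeBlock x v ∧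
    ¬ (IsLeaf u ∧ IsLeaf v)
  symm := ⟨fun _ _ h => ⟨h.1.symm, h.2.2.1 ▸ h.2.1, h.2.2.1.symm, fun h' => h.2.2.2 h'.symm⟩⟩
  loopless := ⟨fun _ h => h.1 rfl⟩

/-- A graph without an induced path or cycle on four vertices is chordal, since every longer cycle
contains an induced path on four vertices. -/
theorem isChordal_of_no_induced_path {V : Type*} {G : SimpleGraph V}
    (h : ∀ a b c d, a ≠ c → b ≠ d → G.Adj a b → G.Adj b c → G.Adj c d → ¬ G.Adj a c →
      G.Adj b d) : IsChordal G := by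
  rintro n hn ⟨f⟩
  have hadj : ∀ i j (hi : i < n) (hj : j < n), i < j →
      ((SimpleGraph.cycleGraph n).Adj ⟨i, hi⟩ ⟨j, hj⟩ ↔ j = i + 1 ∨ (i = 0 ∧ j + 1 = n)) := by
    intro i j hi hj hij
    rw [SimpleGraph.cycleGraph_adj', Fin.val_sub, Fin.val_sub]
    simp only
    rw [show n - i + j = (j - i) + n by omega, Nat.add_mod_right,
      Nat.mod_eq_of_lt (show j - i < n by omega), Nat.mod_eq_of_lt (show n - j + i < n by omega)]
    omega
  have hf : ∀ i j (hi : i < n) (hj : j < n), i < j →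
      (G.Adj (f ⟨i, hi⟩) (f ⟨j, hj⟩) ↔ j = i + 1 ∨ (i = 0 ∧ j + 1 = n)) :=
    fun i j hi hj hij => f.map_adj_iff.trans (hadj i j hi hj hij)
  have h13 := h (f ⟨0, by omega⟩) (f ⟨1, by omega⟩) (f ⟨2, by omega⟩) (f ⟨3, by omega⟩)
    (fun he => by simpa using f.injective he) (fun he => by simpa using f.injective he)
    ((hf _ _ _ _ (by omega)).2 (by omega)) ((hf _ _ _ _ (by omega)).2 (by omega))
    ((hf _ _ _ _ (by omega)).2 (by omega)) (fun ha => by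
      have := (hf _ _ _ _ (by omega)).1 ha
      omega)
  have := (hf _ _ _ _ (by omega)).1 h13
  omega

theorem isChordal_blockGraph (x : Fin M → Fin k → Bool) : IsChordal (blockGraph m r x) := by
  refine isChordal_of_no_induced_path fun a b c d _ hbd hab hbc hcd hn => ?_
  -- Non-adjacent vertices of one block are leaves, so `b` cannot be a leaf.
  have hleaf : IsLeaf a ∧ IsLeaf c := by
    by_contra h
    exact hn ⟨‹_›, hab.2.1, hab.2.2.1.trans hbc.2.2.1, h⟩
  exact ⟨hbd, hbc.2.1, hbc.2.2.1.trans hcd.2.2.1, fun h => hab.2.2.2 ⟨hleaf.1, h.1⟩⟩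

/-- The core vertices of a block get different colours, and all leaves share one more. -/
theorem blockGraph_colorable (hk : 0 < k) (x : Fin M → Fin k → Bool) :
    (blockGraph m r x).Colorable (k + min m 1) := by
  refine ⟨SimpleGraph.Coloring.mk (fun u => match u with
    | .inl (_, .inl i) => ⟨i, by omega⟩
    | .inl (_, .inr l) => ⟨k, by have := l.pos; omega⟩
    | .inr _ => ⟨0, by omega⟩) ?_⟩
  rintro (⟨b, i | l⟩ | u) (⟨b', i' | l'⟩ | u') ⟨hne, hact, heq, hleaf⟩ hc
  · simp only [activeBlock] at hact heq
    simp only [Fin.mk.injEq, Fin.val_inj] at hc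
    subst hc
    apply hne
    split_ifs at * <;> simp_all
  · simp only [Fin.mk.injEq] at hc
    exact absurd hc i.isLt.ne
  · simp [activeBlock] at hact heq
    rw [heq] at hact
    cases hact
  · simp only [Fin.mk.injEq] at hc
    exact absurd hc i'.isLt.ne'
  · exact hleaf ⟨trivial, trivial⟩
  · simp [activeBlock] at heq
  · exact hact rfl
  · exact hact rfl
  · exact hact rfl

open Classical in
theorem blockGraph_degree_le (x : Fin M → Fin k → Bool) (u : BlockVertex M k m r) :
    (blockGraph m r x).degree u ≤ k + m - 1 := by
  have hact : ∀ (v : BlockVertex M k m r) b, activeBlock x v = some b → ∃ w, v = .inl (b, w) := by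
    rintro (⟨b', i | l⟩ | v) b h
    · simp only [activeBlock] at h
      split_ifs at h
      exact ⟨_, by rw [Option.some.inj h]⟩
    · exact ⟨_, by rw [← Option.some.inj h]⟩
    · simp [activeBlock] at h
  rw [← SimpleGraph.card_neighborFinset_eq_degree]
  cases h : activeBlock x u with
  | none =>
    rw [card_eq_zero.2]
    · exact Nat.zero_le _
    · rw [eq_empty_iff_forall_notMem]
      intro v hv
      exact ((SimpleGraph.mem_neighborFinset _ _ _).1 hv).2.1 h
  | some b =>
    have hsub : (blockGraph m r x).neighborFinset u ⊆
        (univ.image fun w : Fin k ⊕ Fin m => (Sum.inl (b, w) : BlockVertex M k m r)).erase u := by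
      intro v hv
      have hv := (SimpleGraph.mem_neighborFinset _ _ _).1 hv
      obtain ⟨w, rfl⟩ := hact v b (hv.2.2.1.symm.trans h)
      exact mem_erase.2 ⟨hv.1.symm, mem_image_of_mem _ (mem_univ _)⟩
    obtain ⟨w, rfl⟩ := hact u b h
    refine (card_le_card hsub).trans ?_
    rw [card_erase_of_mem (mem_image_of_mem _ (mem_univ _))]
    refine Nat.sub_le_sub_right (card_image_le.trans ?_) 1
    simp

/-- The number of components of a block whose active core vertices are given by `y`. -/
def blockCC (m : ℕ) (y : Fin k → Bool) : ℝ :=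
  (∑ i, if y i then 0 else 1) + if ∃ i, y i then 1 else m

open Classical in
/-- A vertex of a block with an active core vertex is represented by such a core vertex. -/
noncomputable def blockRep (x : Fin M → Fin k → Bool) (u : BlockVertex M k m r) :
    BlockVertex M k m r :=
  match activeBlock x u with
  | none => u
  | some b => if h : ∃ i, x b i then .inl (b, .inl h.choose) else u

theorem isRep_blockRep (x : Fin M → Fin k → Bool) :
    IsRep (blockGraph m r x) (blockRep x) := by
  constructor
  · rintro u v ⟨hne, hact, heq, hleaf⟩
    obtain ⟨b, hb⟩ := Option.ne_none_iff_exists'.1 hact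
    have hex : ∃ i, x b i := by
      have hcore : ∀ w : BlockVertex M k m r, ¬ IsLeaf w → activeBlock x w = some b →
          ∃ i, x b i := by
        rintro (⟨b', i | l⟩ | w) hw h
        · simp only [activeBlock] at h
          split_ifs at h with hi
          exact ⟨i, Option.some.inj h ▸ hi⟩
        · exact absurd trivial hw
        · simp [activeBlock] at h
      by_cases hu : IsLeaf u
      · exact hcore v (fun hv => hleaf ⟨hu, hv⟩) (heq ▸ hb)
      · exact hcore u hu hb
    simp only [blockRep, ← heq, hb, hex, dif_pos]
  · intro u
    cases hb : activeBlock x u with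
    | none => simp only [blockRep, hb]; rfl
    | some b =>
      by_cases hex : ∃ i, x b i
      · simp only [blockRep, hb, hex, dif_pos]
        by_cases hu : u = .inl (b, .inl hex.choose)
        · rw [← hu]
        · have hrep : activeBlock (m := m) (r := r) x (.inl (b, .inl hex.choose)) = some b :=
            if_pos hex.choose_spec
          exact SimpleGraph.Adj.reachable ⟨hu, by simp [hb], hb.trans hrep.symm, fun h => h.2⟩
      · simp only [blockRep, hb, hex, dif_neg, not_false_eq_true]; rfl

theorem cc_blockGraph (x : Fin M → Fin k → Bool) :
    (cc (blockGraph m r x) : ℝ) = r + ∑ b, blockCC m (x b) := by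
  classical
  rw [(isRep_blockRep x).cc_eq, card_filter, Nat.cast_sum, Fintype.sum_sum_type,
    Fintype.sum_prod_type, add_comm]
  congr 1
  · simp [blockRep, activeBlock]
  · refine sum_congr rfl fun b _ => ?_
    rw [Fintype.sum_sum_type, blockCC]
    by_cases hex : ∃ i, x b i
    · have hi : ∀ i : Fin k, (((if blockRep (m := m) (r := r) x (.inl (b, .inl i)) =
          .inl (b, .inl i) then 1 else 0 : ℕ)) : ℝ) =
          (if x b i then 0 else 1) + if i = hex.choose then 1 else 0 := by
        intro i
        by_cases h : x b i
        · simp [blockRep, activeBlock, h, hex, @eq_comm _ i]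
        · have : i ≠ hex.choose := fun h' => h (h' ▸ hex.choose_spec)
          simp [blockRep, activeBlock, h, this]
      rw [sum_congr rfl fun i _ => hi i, sum_add_distrib]
      simp [blockRep, activeBlock, hex]
    · have hex' : ∀ i, x b i = false := by simpa using hex
      simp [blockRep, activeBlock, hex']

theorem sum_prod_bits (f : Fin k → Bool → ℝ) :
    ∑ y : Fin k → Bool, ∏ i, f i (y i) = ∏ i, (f i false + f i true) := by
  have := (prod_univ_sum (fun _ : Fin k => (univ : Finset Bool)) f).symm
  rw [Fintype.piFinset_univ] at this
  rw [this]
  exact prod_congr rfl fun i _ => by rw [Fintype.sum_bool, add_comm]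

/-- The correlation of the number of components of a block with its parity. It comes from the block
without active core vertices, which has `m` components instead of one; the number of inactive core
vertices is uncorrelated with the parity unless `k = 1`. -/
theorem sum_blockCC_mul_paritySign (hk : 0 < k) (m : ℕ) :
    ∑ y : Fin k → Bool, blockCC m y * paritySign y = k * 0 ^ (k - 1) + (m - 1) := by
  have hsplit : ∀ y : Fin k → Bool, blockCC m y * paritySign y =
      ∑ i, (∏ j, if j = i then (if y j then 0 else 1) else (if y j then -1 else 1)) +
        (paritySign y + (m - 1) * ∏ i : Fin k, if y i then (0 : ℝ) else 1) := by
    intro y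
    rw [blockCC, add_mul, sum_mul]
    congr 1
    · refine sum_congr rfl fun i _ => ?_
      rw [paritySign, ← mul_prod_erase univ _ (mem_univ i), ← mul_prod_erase univ _ (mem_univ i),
        prod_congr rfl fun j hj => if_neg (ne_of_mem_erase hj)]
      cases y i <;> simp
    · by_cases hex : ∃ i, y i
      · obtain ⟨i, hi⟩ := hex
        have h0 : (∏ i : Fin k, if y i then (0 : ℝ) else 1) = 0 :=
          prod_eq_zero (mem_univ i) (if_pos hi)
        rw [if_pos ⟨i, hi⟩, h0]
        ring
      · have hex' : ∀ i, y i = false := by simpa using hex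
        simp [paritySign, hex']
  have h1 : ∀ i : Fin k, ∑ y : Fin k → Bool,
      (∏ j, if j = i then (if y j then (0 : ℝ) else 1) else (if y j then -1 else 1)) =
      0 ^ (k - 1) := by
    intro i
    rw [sum_prod_bits fun j c => if j = i then (if c then 0 else 1) else (if c then -1 else 1),
      ← mul_prod_erase univ _ (mem_univ i), prod_congr rfl (g := fun _ => (0 : ℝ)), prod_const,
      card_erase_of_mem (mem_univ i)]
    · simp
    · intro j hj
      simp [ne_of_mem_erase hj]
  have h2 : ∑ y : Fin k → Bool, paritySign y = 0 := by
    simp only [paritySign]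
    rw [sum_prod_bits fun _ c => if c then -1 else 1]
    simp [hk.ne']
  have h3 : ∑ y : Fin k → Bool, (∏ i : Fin k, if y i then (0 : ℝ) else 1) = 1 := by
    rw [sum_prod_bits fun _ c => if c then 0 else 1]
    simp
  simp only [hsplit, sum_add_distrib, ← mul_sum, h2, h3]
  rw [sum_comm]
  simp [h1]

end BlockGraph

/-! ### The lower bound given by a block graph -/

section LowerBound

variable {N M k m r : ℕ}

theorem blockGraph_comap_mem (hk : 0 < k) {d ω : ℕ} (hd : k + m ≤ d + 1) (hω : k + min m 1 ≤ ω)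
    (ψ : Fin N ≃ BlockVertex M k m r) (x : Fin M → Fin k → Bool) :
    (blockGraph m r x).comap ψ ∈ chordalClass N d ω := by
  classical
  let φ : (blockGraph m r x).comap ψ ≃g blockGraph m r x := SimpleGraph.Iso.comap ψ _
  refine ⟨fun n hn ⟨f⟩ => isChordal_blockGraph x n hn ⟨φ.toEmbedding.comp f⟩, ?_, ?_⟩
  · refine SimpleGraph.maxDegree_le_of_forall_degree_le _ _ fun v => ?_
    have h := (φ.degree_eq v).symm.trans_le (blockGraph_degree_le x (φ v))
    refine le_of_eq_of_le ?_ (h.trans (show k + m - 1 ≤ d by omega))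
    congr!
  · obtain ⟨s, hs⟩ := ((blockGraph m r x).comap ψ).exists_isNClique_cliqueNum
    rw [← hs.card_eq]
    exact (hs.isClique.card_le_of_colorable
      ((blockGraph_colorable hk x).of_hom φ.toHom)).trans hω

theorem cc_comap (ψ : Fin N ≃ BlockVertex M k m r) (x : Fin M → Fin k → Bool) :
    (cc ((blockGraph m r x).comap ψ) : ℝ) = r + ∑ b, blockCC m (x b) := by
  rw [← cc_blockGraph (m := m) (r := r)]
  exact congrArg _ (Nat.card_congr
    (SimpleGraph.Iso.comap ψ (blockGraph m r x)).connectedComponentEquiv)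

/-- The core vertices of the block `b`. -/
def coreSet (ψ : Fin N ≃ BlockVertex M k m r) (b : Fin M) : Finset (Fin N) :=
  univ.map ⟨fun i : Fin k => ψ.symm (.inl (b, .inl i)), fun i j h => by simpa using h⟩

theorem card_coreSet (ψ : Fin N ≃ BlockVertex M k m r) (b : Fin M) : (coreSet ψ b).card = k := by
  simp [coreSet]

/-- The blocks all of whose core vertices have been sampled. -/
def fullBlocks (ψ : Fin N ≃ BlockVertex M k m r) (S : Finset (Fin N)) : Finset (Fin M) :=
  univ.filter fun b => coreSet ψ b ⊆ S

/-- If a core vertex of a block is not sampled, the observation does not depend on its bit. -/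
theorem exists_sampled_flipBit (ψ : Fin N ≃ BlockVertex M k m r) {S : Finset (Fin N)} {b : Fin M}
    (hb : b ∉ fullBlocks ψ S) : ∃ i, ∀ x,
      sampled ((blockGraph m r (flipBit b i x)).comap ψ) S =
        sampled ((blockGraph m r x).comap ψ) S := by
  have hb' : ¬ coreSet ψ b ⊆ S := by simpa [fullBlocks] using hb
  obtain ⟨v, hv, hvS⟩ := not_subset.1 hb'
  obtain ⟨i, -, rfl⟩ := mem_map.1 hv
  refine ⟨i, fun x => ?_⟩
  have hact : ∀ v : S, activeBlock (flipBit b i x) (ψ v) = activeBlock x (ψ v) := by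
    rintro ⟨v, hvm⟩
    have hne : ψ v ≠ .inl (b, .inl i) := by
      intro h
      apply hvS
      change ψ.symm (.inl (b, .inl i)) ∈ S
      rwa [← h, Equiv.symm_apply_apply]
    change activeBlock (flipBit b i x) (ψ v) = activeBlock x (ψ v)
    rcases h : ψ v with ⟨b', i' | l⟩ | u
    · have : (b', i') ≠ (b, i) := fun h' => hne (by
        rw [h, (Prod.mk.inj h').1, (Prod.mk.inj h').2])
      simp only [activeBlock, flipBit_apply_of_ne this]
    · rfl
    · rfl
  ext u v
  simp only [sampled, SimpleGraph.comap_adj, blockGraph, hact]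

theorem sum_sampleProb_card_fullBlocks (p : ℝ) (ψ : Fin N ≃ BlockVertex M k m r) :
    ∑ S, sampleProb p S * (fullBlocks ψ S).card = M * p ^ k := by
  have h : ∀ S : Finset (Fin N), sampleProb p S * (fullBlocks ψ S).card =
      ∑ b, if coreSet ψ b ⊆ S then sampleProb p S else 0 := by
    intro S
    rw [← sum_filter, sum_const, nsmul_eq_mul, mul_comm, fullBlocks]
  rw [sum_congr rfl fun S _ => h S, sum_comm]
  simp [sum_sampleProb_superset, card_coreSet]

/-- By Markov's inequality, with probability at least `1 / 2` there are at most twice as many full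
blocks as expected. -/
theorem half_le_sum_sampleProb {p : ℝ} (hp : 0 < p) (hp1 : p ≤ 1) (hM : 0 < M)
    (ψ : Fin N ≃ BlockVertex M k m r) :
    1 / 2 ≤ ∑ S with ((fullBlocks ψ S).card : ℝ) ≤ 2 * (M * p ^ k), sampleProb p S := by
  have h1 := sum_filter_add_sum_filter_not univ
    (fun S => ((fullBlocks ψ S).card : ℝ) ≤ 2 * (M * p ^ k)) (sampleProb p)
  rw [sum_sampleProb] at h1
  have hpos : 0 < (M : ℝ) * p ^ k := by positivity
  have h2 : (∑ S with ¬ ((fullBlocks ψ S).card : ℝ) ≤ 2 * (M * p ^ k), sampleProb p S) *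
      (2 * (M * p ^ k)) ≤ M * p ^ k := by
    refine le_trans ?_ (sum_sampleProb_card_fullBlocks p ψ).le
    rw [sum_mul]
    refine (sum_le_sum fun S hS => ?_).trans (sum_le_sum_of_subset_of_nonneg (filter_subset _ _)
      fun S _ _ => mul_nonneg (sampleProb_nonneg hp.le hp1 S) (Nat.cast_nonneg _))
    exact mul_le_mul_of_nonneg_left (not_le.1 (mem_filter.1 hS).2).le
      (sampleProb_nonneg hp.le hp1 S)
  nlinarith

theorem ofReal_le_minimaxMSE {d ω : ℕ} {p B : ℝ}
    (h : ∀ (f : Estimator N) (R : ℝ), (∀ G ∈ chordalClass N d ω, mse p f G ≤ R) → B ≤ R) :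
    ENNReal.ofReal B ≤ minimaxMSE N d ω p := by
  refine le_iInf fun f => ?_
  by_contra! hlt
  set t := ⨆ G ∈ chordalClass N d ω, ENNReal.ofReal (mse p f G) with ht
  have htop : t ≠ ⊤ := hlt.ne_top
  have hB := h f t.toReal fun G hG =>
    (ENNReal.ofReal_le_iff_le_toReal htop).1
      (le_iSup₂ (f := fun G (_ : G ∈ chordalClass N d ω) => ENNReal.ofReal (mse p f G)) G hG)
  exact absurd (ENNReal.ofReal_le_of_le_toReal hB) hlt.not_ge

/-- The minimax lower bound given by `M` blocks of `k` core vertices and `m` leaves. It compares the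
error under the uniform prior with the error under the prior whose parities have the bias `e`. -/
theorem blockBound_le_minimaxMSE (hk : 0 < k) (hM : 0 < M) (hN : M * (k + m) ≤ N) {d ω : ℕ}
    (hd : k + m ≤ d + 1) (hω : k + min m 1 ≤ ω) {p : ℝ} (hp : 0 < p) (hp1 : p ≤ 1 / 4) :
    ENNReal.ofReal (((k * 0 ^ (k - 1) + (m - 1) : ℝ) / 2 ^ k) ^ 2 / 128 *
      min ((M : ℝ) ^ 2) (M / p ^ k)) ≤ minimaxMSE N d ω p := by
  refine ofReal_le_minimaxMSE fun f R hR => ?_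
  set lam := (k * 0 ^ (k - 1) + (m - 1) : ℝ) / 2 ^ k with hlam
  have hcard : Fintype.card (Fin N) = Fintype.card (BlockVertex M k m (N - M * (k + m))) := by
    simp only [Fintype.card_fin, Fintype.card_sum, Fintype.card_prod]
    omega
  let ψ : Fin N ≃ BlockVertex M k m (N - M * (k + m)) := Fintype.equivOfCardEq hcard
  set t := (M : ℝ) * p ^ k with ht
  have hM' : (0 : ℝ) < M := by exact_mod_cast hM
  have ht0 : 0 < t := by positivity
  have hpk : p ^ k ≤ 1 / 4 := (pow_le_of_le_one hp.le (by linarith) hk.ne').trans hp1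
  -- The bias: of order `1 / √t`, so that the parities of about `t` full blocks do not reveal it.
  set e := √(min 1 (1 / (2 * t))) with he
  have hmin0 : 0 < min 1 (1 / (2 * t)) := by positivity
  have he2 : e ^ 2 = min 1 (1 / (2 * t)) := Real.sq_sqrt hmin0.le
  have he0 : 0 ≤ e := Real.sqrt_nonneg _
  have he1 : e ≤ 1 := Real.sqrt_le_one.2 (min_le_left _ _)
  set n : ℝ := (2 ^ k) ^ M with hn
  have hn0 : 0 < n := by positivity
  set G := fun x : Fin M → Fin k → Bool => (blockGraph m (N - M * (k + m)) x).comap ψ with hG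
  have hS : ∀ S : Finset (Fin N), ((fullBlocks ψ S).card : ℝ) ≤ 2 * t →
      (e * lam * (M / 2)) ^ 2 * n ≤
        ∑ x, (2 * tilt e univ x + 6) * (f S (sampled (G x) S) - cc (G x)) ^ 2 := by
    intro S hSt
    have h := sq_shift_le hk he0 he1 ((N - M * (k + m) : ℕ) : ℝ) (blockCC m) (fullBlocks ψ S)
      (F := fun x => f S (sampled (G x) S)) fun b hb => by
        obtain ⟨i, hi⟩ := exists_sampled_flipBit ψ hb
        exact ⟨i, fun x => by simp only [hG, hi]⟩
    rw [sum_blockCC_mul_paritySign hk] at h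
    simp only [← cc_comap ψ] at h
    have hexp : (1 + e ^ 2) ^ (fullBlocks ψ S).card ≤ 3 := by
      calc (1 + e ^ 2) ^ (fullBlocks ψ S).card
          ≤ Real.exp (e ^ 2) ^ (fullBlocks ψ S).card := by
            gcongr
            linarith [Real.add_one_le_exp (e ^ 2)]
        _ = Real.exp ((fullBlocks ψ S).card * e ^ 2) := (Real.exp_nat_mul _ _).symm
        _ ≤ Real.exp 1 := by
            refine Real.exp_le_exp.2 ?_
            calc _ ≤ 2 * t * (1 / (2 * t)) := by
                  rw [he2]
                  exact mul_le_mul hSt (min_le_right _ _) hmin0.le (by positivity)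
              _ = 1 := by field_simp
        _ ≤ 3 := by linarith [Real.exp_one_lt_d9]
    have hMb : (M : ℝ) / 2 ≤ M - (fullBlocks ψ S).card := by
      have : t ≤ M * (1 / 4) := by rw [ht]; gcongr
      linarith
    calc (e * lam * (M / 2)) ^ 2 * n
        = (e * lam) ^ 2 * ((M : ℝ) / 2) ^ 2 * n := by ring
      _ ≤ (e * lam) ^ 2 * ((M : ℝ) - (fullBlocks ψ S).card) ^ 2 * n := by gcongr
      _ = (e * lam * ((M : ℝ) - (fullBlocks ψ S).card)) ^ 2 * n := by ring
      _ ≤ _ := h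
      _ ≤ _ := by
          refine sum_le_sum fun x _ => mul_le_mul_of_nonneg_right ?_ (sq_nonneg _)
          linarith
  have hsum : 1 / 2 * ((e * lam * (M / 2)) ^ 2 * n) ≤ 8 * n * R := by
    calc 1 / 2 * ((e * lam * (M / 2)) ^ 2 * n)
        ≤ (∑ S with ((fullBlocks ψ S).card : ℝ) ≤ 2 * t, sampleProb p S) *
            ((e * lam * (M / 2)) ^ 2 * n) := by
          gcongr
          exact half_le_sum_sampleProb hp (by linarith) hM ψ
      _ ≤ ∑ S with ((fullBlocks ψ S).card : ℝ) ≤ 2 * t, sampleProb p S *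
            ∑ x, (2 * tilt e univ x + 6) * (f S (sampled (G x) S) - cc (G x)) ^ 2 := by
          rw [sum_mul]
          refine sum_le_sum fun S h => mul_le_mul_of_nonneg_left (hS S (mem_filter.1 h).2)
            (sampleProb_nonneg hp.le (by linarith) S)
      _ ≤ ∑ S, sampleProb p S *
            ∑ x, (2 * tilt e univ x + 6) * (f S (sampled (G x) S) - cc (G x)) ^ 2 := by
          refine sum_le_sum_of_subset_of_nonneg (filter_subset _ _) fun S _ _ =>
            mul_nonneg (sampleProb_nonneg hp.le (by linarith) S) (sum_nonneg fun x _ => ?_)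
          have := tilt_nonneg he0 he1 univ x
          positivity
      _ = ∑ x, (2 * tilt e univ x + 6) * mse p f (G x) := by
          simp only [mul_sum, mse]
          rw [sum_comm]
          exact sum_congr rfl fun x _ => sum_congr rfl fun S _ => by ring
      _ ≤ ∑ x, (2 * tilt e univ x + 6) * R := by
          refine sum_le_sum fun x _ => mul_le_mul_of_nonneg_left
            (hR _ (blockGraph_comap_mem hk hd hω ψ x)) ?_
          have := tilt_nonneg he0 he1 univ x
          positivity
      _ = 8 * n * R := by
          rw [← sum_mul, sum_add_distrib, ← mul_sum, sum_tilt hk]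
          simp only [sum_const, card_univ, Fintype.card_fun, Fintype.card_fin, Fintype.card_bool,
            nsmul_eq_mul, hn]
          push_cast
          ring
  have hfin : e ^ 2 * lam ^ 2 * (M : ℝ) ^ 2 / 64 ≤ R := by
    have : n * (e ^ 2 * lam ^ 2 * (M : ℝ) ^ 2 / 64) ≤ n * R := by linarith
    exact le_of_mul_le_mul_left this hn0
  refine le_trans ?_ hfin
  have hkey : min ((M : ℝ) ^ 2) (M / p ^ k) ≤ 2 * (e ^ 2 * (M : ℝ) ^ 2) := by
    rw [he2]
    rcases min_choice 1 (1 / (2 * t)) with h | h <;> rw [h]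
    · refine (min_le_left _ _).trans ?_
      nlinarith [sq_nonneg (M : ℝ)]
    · refine (min_le_right _ _).trans (le_of_eq ?_)
      rw [ht]
      field_simp
  nlinarith [sq_nonneg lam]

end LowerBound

/-! ### The choice of the blocks -/

section Rate

variable {N d ω : ℕ} {p : ℝ}

/-- Two vertices that may or may not be joined: already one component is hard to count. -/
theorem const_le_minimaxMSE (hN : 2 ≤ N) (hω : 2 ≤ ω) (hd : 1 ≤ d) (hp : 0 < p) (hp1 : p ≤ 1 / 4) :
    ENNReal.ofReal (1 / 2048) ≤ minimaxMSE N d ω p := by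
  refine le_trans (ENNReal.ofReal_le_ofReal ?_)
    (blockBound_le_minimaxMSE (M := 1) (k := 2) (m := 0) two_pos one_pos (by omega)
      (by omega) (by omega) hp hp1)
  have h : (1 : ℝ) ≤ 1 / p ^ 2 := by
    rw [le_div_iff₀ (by positivity), one_mul]
    exact pow_le_one₀ hp.le (by linarith)
  rw [min_eq_left (by simpa using h)]
  norm_num

theorem half_div_le_floor {a b : ℕ} (hb : 0 < b) (hab : b ≤ a) :
    (a : ℝ) / (2 * b) ≤ ((a / b : ℕ) : ℝ) := by
  have h1 : a < b * (a / b + 1) := by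
    have := Nat.div_add_mod a b
    have := Nat.mod_lt a hb
    rw [mul_add]; omega
  have h2 : 1 ≤ a / b := (Nat.one_le_div_iff hb).2 hab
  have h3 : (a : ℝ) ≤ b * ((a / b : ℕ) + 1) := by exact_mod_cast h1.le
  have h4 : (1 : ℝ) ≤ (a / b : ℕ) := by exact_mod_cast h2
  have hb' : (0 : ℝ) < b := by exact_mod_cast hb
  rw [div_le_iff₀ (by positivity)]
  nlinarith

/-- Blocks of `ω` core vertices without leaves, that is, cliques `K_ω` with hidden parts. -/
theorem min_div_pow_le_minimaxMSE (hω : 2 ≤ ω) (hN : ω ≤ N) (hd : ω - 1 ≤ d) (hp : 0 < p)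
    (hp1 : p ≤ 1 / 4) :
    ENNReal.ofReal (1 / (512 * ω ^ 2 * 4 ^ ω) * min ((N : ℝ) ^ 2) (N / p ^ ω)) ≤
      minimaxMSE N d ω p := by
  have hω0 : 0 < ω := by omega
  have hω1 : (1 : ℝ) ≤ ω := by exact_mod_cast hω0
  refine le_trans (ENNReal.ofReal_le_ofReal ?_)
    (blockBound_le_minimaxMSE (M := N / ω) (k := ω) (m := 0) hω0 (Nat.div_pos hN hω0)
      (by simpa using Nat.div_mul_le_self N ω) (by omega) (by omega) hp hp1)
  have hM := half_div_le_floor hω0 hN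
  have hlam : ((ω * 0 ^ (ω - 1) + ((0 : ℕ) - 1) : ℝ) / 2 ^ ω) ^ 2 = 1 / 4 ^ ω := by
    rw [zero_pow (by omega), div_pow, ← pow_mul, mul_comm ω 2, pow_mul]
    norm_num
  rw [hlam]
  have hmin : 1 / (4 * ω ^ 2) * min ((N : ℝ) ^ 2) (N / p ^ ω) ≤
      min (((N / ω : ℕ) : ℝ) ^ 2) ((N / ω : ℕ) / p ^ ω) := by
    refine le_min ?_ ?_
    · calc _ ≤ 1 / (4 * (ω : ℝ) ^ 2) * (N : ℝ) ^ 2 := by gcongr; exact min_le_left _ _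
        _ = ((N : ℝ) / (2 * ω)) ^ 2 := by field_simp; ring
        _ ≤ _ := by gcongr
    · calc _ ≤ 1 / (4 * (ω : ℝ) ^ 2) * (N / p ^ ω) := by gcongr; exact min_le_right _ _
        _ ≤ 1 / (2 * ω) * (N / p ^ ω) := by
            have : 2 * (ω : ℝ) ≤ 4 * ω ^ 2 := by nlinarith
            gcongr ?_ * _
            exact one_div_le_one_div_of_le (by positivity) this
        _ = (N : ℝ) / (2 * ω) / p ^ ω := by field_simp
        _ ≤ _ := by gcongr
  calc _ = 1 / 4 ^ ω / 128 * (1 / (4 * (ω : ℝ) ^ 2) * min ((N : ℝ) ^ 2) (N / p ^ ω)) := by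
        field_simp; ring
    _ ≤ _ := by gcongr

/-- Blocks of `ω - 1` core vertices and about `min d N / 2` leaves. A block without active core
vertices has as many components as leaves, which shifts the number of components by the order of
`min d N`. -/
theorem min_mul_div_pow_le_minimaxMSE (hω : 2 ≤ ω) (hN : 2 * ω ≤ N) (hd : 2 * ω ≤ d) (hp : 0 < p)
    (hp1 : p ≤ 1 / 4) :
    ENNReal.ofReal (1 / (24576 * 4 ^ ω) * min ((N : ℝ) ^ 2) (N * d / p ^ (ω - 1))) ≤
      minimaxMSE N d ω p := by
  obtain ⟨k, rfl⟩ : ∃ k, ω = k + 1 := ⟨ω - 1, by omega⟩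
  rw [Nat.add_sub_cancel]
  set m := min d N / 2 with hm
  have hkm : k + 1 ≤ m := by omega
  have hmd : 2 * m ≤ d := by omega
  have hmN : 2 * m ≤ N := by omega
  have hk : 0 < k := by omega
  refine le_trans (ENNReal.ofReal_le_ofReal ?_)
    (blockBound_le_minimaxMSE (M := N / (k + m)) (k := k) (m := m) hk
      (Nat.div_pos (by omega) (by omega)) (Nat.div_mul_le_self N (k + m)) (by omega) (by omega)
      hp hp1)
  have hM0 := half_div_le_floor (a := N) (b := k + m) (by omega) (by omega)
  set M := N / (k + m) with hMdef
  have hm2 : (2 : ℝ) ≤ m := by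
    have : 2 ≤ m := by omega
    exact_mod_cast this
  have hkm' : (k : ℝ) ≤ m := by
    have : k ≤ m := by omega
    exact_mod_cast this
  have hM : (N : ℝ) / (4 * m) ≤ M := by
    refine le_trans ?_ hM0
    push_cast
    exact div_le_div_of_nonneg_left (by positivity) (by positivity) (by linarith)
  have hpk : 0 < p ^ k := by positivity
  have hpk1 : p ^ k ≤ 1 := pow_le_one₀ hp.le (by linarith)
  have hlam : (m : ℝ) ^ 2 / 4 / 4 ^ k ≤ ((k * 0 ^ (k - 1) + (m - 1) : ℝ) / 2 ^ k) ^ 2 := by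
    rw [div_pow, ← pow_mul, mul_comm k 2, pow_mul]
    norm_num
    have h0 : (0 : ℝ) ≤ k * 0 ^ (k - 1) := by positivity
    gcongr
    calc (m : ℝ) ^ 2 / 4 = (m / 2) ^ 2 := by ring
      _ ≤ _ := by gcongr; linarith
  -- Either `m` is of order `d`, or it is of order `N` and the trivial bound `N ^ 2` is reached.
  have hmin : (m : ℝ) ^ 2 * min ((M : ℝ) ^ 2) (M / p ^ k) ≥
      1 / 48 * min ((N : ℝ) ^ 2) (N * d / p ^ k) := by
    have hNm : (N : ℝ) ≤ 4 * m * M := by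
      rwa [div_le_iff₀ (by positivity), mul_comm] at hM
    rcases min_choice ((M : ℝ) ^ 2) (M / p ^ k) with h | h <;> rw [h, ge_iff_le]
    · calc _ ≤ 1 / 48 * (N : ℝ) ^ 2 := by gcongr; exact min_le_left _ _
        _ ≤ 1 / 48 * (4 * m * M) ^ 2 := by gcongr
        _ ≤ _ := by nlinarith [sq_nonneg ((m : ℝ) * M)]
    · have hstep : (N : ℝ) * m / 4 / p ^ k ≤ (m : ℝ) ^ 2 * (M / p ^ k) := by
        rw [← mul_div_assoc]
        gcongr
        nlinarith
      refine le_trans ?_ hstep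
      rcases le_total d N with hdN | hdN
      · have h3 : (d : ℝ) ≤ 3 * m := by
          have : d ≤ 3 * m := by omega
          exact_mod_cast this
        calc _ ≤ 1 / 48 * (N * d / p ^ k) := by gcongr; exact min_le_right _ _
          _ ≤ 1 / 48 * (N * (3 * m) / p ^ k) := by gcongr
          _ = 1 / 4 * ((N : ℝ) * m / 4 / p ^ k) := by ring
          _ ≤ _ := by
              have : 0 ≤ (N : ℝ) * m / 4 / p ^ k := by positivity
              linarith
      · have h3 : (N : ℝ) ≤ 3 * m := by
          have : N ≤ 3 * m := by omega
          exact_mod_cast this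
        calc _ ≤ 1 / 48 * (N : ℝ) ^ 2 := by gcongr; exact min_le_left _ _
          _ ≤ (N : ℝ) * m / 4 := by nlinarith [(Nat.cast_nonneg N : (0 : ℝ) ≤ N)]
          _ ≤ _ := le_div_self (by positivity) hpk hpk1
  have hmin0 : 0 ≤ min ((M : ℝ) ^ 2) (M / p ^ k) := by positivity
  calc _ = 1 / (512 * 4 ^ k) * (1 / 48 * min ((N : ℝ) ^ 2) (N * d / p ^ k)) * (1 / 4) := by
        rw [pow_succ]; field_simp; ring
    _ ≤ 1 / (512 * 4 ^ k) * (1 / 48 * min ((N : ℝ) ^ 2) (N * d / p ^ k)) * 1 := by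
        gcongr
        norm_num
    _ ≤ 1 / (512 * 4 ^ k) * ((m : ℝ) ^ 2 * min ((M : ℝ) ^ 2) (M / p ^ k)) * 1 := by gcongr
    _ = (m : ℝ) ^ 2 / 4 / 4 ^ k / 128 * min ((M : ℝ) ^ 2) (M / p ^ k) := by
        field_simp; ring
    _ ≤ _ := by gcongr

theorem rate_le_minimaxMSE (hω : 2 ≤ ω) (hN : 2 ≤ N) (hd : ω - 1 ≤ d) (hp : 0 < p)
    (hp1 : p < 1 / (2 ^ ω * 100)) :
    ENNReal.ofReal (1 / (24576 * ω ^ 2 * 4 ^ ω) * rate N d ω p) ≤ minimaxMSE N d ω p := by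
  have h2ω : (ω : ℝ) < 2 ^ ω := by exact_mod_cast Nat.lt_two_pow_self
  have hω2 : (2 : ℝ) ≤ ω := by exact_mod_cast hω
  have h4ω : (1 : ℝ) ≤ 4 ^ ω := one_le_pow₀ (by norm_num)
  have hpω : p * (2 * ω) < 1 := by
    rw [lt_div_iff₀ (by positivity)] at hp1
    nlinarith
  have hp4 : p ≤ 1 / 4 := by nlinarith
  by_cases hN2 : N < 2 * ω
  · refine le_trans (ENNReal.ofReal_le_ofReal ?_)
      (const_le_minimaxMSE hN hω (by omega) hp hp4)
    have hNω : (N : ℝ) ≤ 2 * ω := by exact_mod_cast hN2.le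
    calc _ ≤ 1 / (24576 * (ω : ℝ) ^ 2 * 4 ^ ω) * (2 * ω) ^ 2 := by
          gcongr
          exact (min_le_right _ _).trans (by gcongr)
      _ = 1 / (6144 * 4 ^ ω) := by field_simp; norm_num
      _ ≤ _ := by
          gcongr
          linarith
  push Not at hN2
  -- The second term of the rate can only dominate if `d > 1 / p`, and then `d` is large.
  rcases le_total ((N : ℝ) * d / p ^ (ω - 1)) (N / p ^ ω) with h | h
  · refine le_trans (ENNReal.ofReal_le_ofReal ?_)
      (min_div_pow_le_minimaxMSE hω (by omega) hd hp hp4)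
    rw [rate, max_eq_left h, min_comm]
    gcongr
    norm_num
  · have hdp : 1 ≤ d * p := by
      have hpow : p ^ ω = p ^ (ω - 1) * p := by rw [← pow_succ, Nat.sub_add_cancel (by omega)]
      have hN0 : (0 : ℝ) < N := by exact_mod_cast (by omega : 0 < N)
      rw [hpow, ← div_div, div_le_iff₀ hp, div_mul_eq_mul_div] at h
      have h' := (div_le_div_iff_of_pos_right (by positivity : 0 < p ^ (ω - 1))).1 h
      nlinarith
    have hd2 : 2 * ω ≤ d := by
      have : (2 * ω : ℝ) ≤ d := by nlinarith
      exact_mod_cast this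
    refine le_trans (ENNReal.ofReal_le_ofReal ?_)
      (min_mul_div_pow_le_minimaxMSE hω hN2 hd2 hp hp4)
    rw [rate, max_eq_right h, min_comm]
    gcongr
    nlinarith

end Rate

end ChordalSampling

theorem theorem11 (ω : ℕ) (hω : 2 ≤ ω) :
    ∃ c C : ℝ, 0 < c ∧ 0 < C ∧
      ∀ (N d : ℕ) (p : ℝ), 0 < p → p < 1 / (2 ^ ω * 100) →
        ChordalSampling.minimaxMSE N d ω p ≤
            ENNReal.ofReal (C * ChordalSampling.rate N d ω p) ∧
        (2 ≤ N → ω - 1 ≤ d →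
          ENNReal.ofReal (c * ChordalSampling.rate N d ω p) ≤
            ChordalSampling.minimaxMSE N d ω p) := by
  have hω0 : (0 : ℝ) < ω := by exact_mod_cast (by omega : 0 < ω)
  refine ⟨1 / (24576 * ω ^ 2 * 4 ^ ω), 2 ^ ω + 2 * 2 ^ ω * (ω * 2 ^ ω), by positivity,
    by positivity, fun N d p hp hp1 => ⟨?_, fun hN hd => ?_⟩⟩
  · refine ChordalSampling.minimaxMSE_le_rate d hω hp (hp1.le.trans ?_)
    rw [div_le_one (by positivity)]
    have : (1 : ℝ) ≤ 2 ^ ω := one_le_pow₀ (by norm_num)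
    linarith
  · exact ChordalSampling.rate_le_minimaxMSE hω hN hd hp hp1
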